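/- **Setting.** Let $\mathsf N$ be an infinite set of names, $\overline{\mathsf N}=\{\bar a: a\in\mathsf N\}$ the co-names ($\bar{\bar a}=a$); $\lambda$ ranges over $\mathsf N\cup\overline{\mathsf N}$ and $\alpha$ over $\mathsf N\cup\overline{\mathsf N}\cup\{\tau\}$. CCS processes are $P,Q ::= P\mid Q \;\|\; \sum_{i}\lambda_i.P_i \;\|\; P\backslash a$ (finite sums, $0$ is the empty sum), taken up to the usual structural congruence of CCS (including $\alpha$-conversion). RCCS processes are $R,S ::= m\rhd P \;\|\; R\mid S\;\|\; R\backslash a$ with memory stacks $m ::= \emptyset \;\|\; \curlyvee.m \;\|\; \langle i,\lambda,P\rangle.m$, $i\in\mathbb N$; $\mathrm{ids}(\cdot)$ is the set of identifiers occurring in a term. Structural equivalence $\equiv$ on RCCS is the least congruence containing the congruence of CCS inside threads, $m\rhd(P\mid Q)\equiv(\curlyvee.m\rhd P)\mid(\curlyvee.m\rhd Q)$, and $m\rhd P\backslash a\equiv(m\rhd P)\backslash a$ when $a$ does not occur in $m$. Forward transitions $R\xrightarrow{i:\alpha}S$ and backward transitions $R\overset{i:\alpha}{\rightsquigarrow}S$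 are generated by: for $i\notin\mathrm{ids}(m)$, $m\rhd\lambda.P+Q\xrightarrow{i:\lambda}\langle i,\lambda,Q\rangle.m\rhd P$ and $\langle i,\lambda,Q\rangle.m\rhd P\overset{i:\lambda}{\rightsquigarrow}m\rhd\lambda.P+Q$; and, in both directions, synchronization of $i:\lambda$ and $i:\bar\lambda$ into $i:\tau$ under $\mid$; a transition with identifier $i$ of one component of $R\mid S$ when $i$ does not occur in the other component; a transition with $\alpha\notin\{a,\bar a\}$ under $\backslash a$; and closure under $\equiv$. An RCCS process $R$ is reachable with origin $O$ (a CCS process) if it is obtained from $\emptyset\rhd O$ by forward and backward transitions, up to $\equiv$; the origin is written $O_R$. **Bisimulations.** A back-and-forth bisimulation (B&F) between reachable $R_1,R_2$ is a relation $\mathcal R$ between two RCCS processes and a partial function $\mathbb N\rightharpoonup\mathbb N$ such that $(\emptyset\rhd O_{R_1},\emptyset\rhd O_{R_2},\emptyset)\in\mathcal R$ and such that for all $(S_1,S_2,f)\in\mathcal R$, $f$ is a bijection between $\mathrm{ids}(S_1)$ and $\mathrm{ids}(S_2)$ and: - each forward transition $S_1\xrightarrow{i:\alpha}S_1'$ is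 matched by some $S_2\xrightarrow{j:\alpha}S_2'$ with $(S_1',S_2',f\cup\{i\mapsto j\})\in\mathcal R$, and symmetrically each $S_2\xrightarrow{j:\alpha}S_2'$ by some $S_1\xrightarrow{i:\alpha}S_1'$ with the same property; - each backward transition $S_1\overset{i:\alpha}{\rightsquigarrow}S_1'$ is matched by some $S_2\overset{j:\alpha}{\rightsquigarrow}S_2'$ with $f(i)=j$ and $(S_1',S_2',f\setminus\{i\mapsto j\})\in\mathcal R$, and symmetrically. A simple back-and-forth bisimulation (SB&F) is a relation between two RCCS processes containing $(\emptyset\rhd O_{R_1},\emptyset\rhd O_{R_2})$ and satisfying the same four matching conditions without any requirement on identifiers. $R_1,R_2$ are B&F (resp. SB&F) if there is a B&F (resp. SB&F) between them; CCS processes $P_1,P_2$ are if $\emptyset\rhd P_1,\emptyset\rhd P_2$ are. **Auto-concurrency.** Let $[\![P]\!]$ be the standard encoding of a CCS process as a labelled configuration structure (prefixing, nondeterministic choice, parallel composition as relabelled and restricted product for the CCS synchronization algebra $\lambda\bullet\bar\lambda=\tau$, $\alpha\bullet\beta=\bot$ otherwise, restriction of the labels $a,\bar a$). In a configuration $x$,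 $d\le_x e$ means that every configuration $y\subseteq x$ with $e\in y$ contains $d$, and $d,e$ are concurrent in $x$ if neither $d<_xe$ nor $e<_xd$. $R$ is without auto-concurrency if, in every configuration of $[\![O_R]\!]$, two concurrent events with the same label are equal. **Theorem (Collapsing B&F and SB&F).** 1. Let $R_1$ and $R_2$ be reachable RCCS processes without auto-concurrency. Then $R_1$ and $R_2$ are B&F if and only if they are SB&F. Moreover, there are a B&F $\mathcal R$ between $R_1$ and $R_2$ and a function $f$ with $(R_1,R_2,f)\in\mathcal R$ if and only if there is an SB&F $\mathcal R$ between $R_1$ and $R_2$ with $(R_1,R_2)\in\mathcal R$. 2. In the presence of auto-concurrency the relations differ: for every name $a$, the process $a\mid a$ is not without auto-concurrency, and $a\mid a$ and $a.a$ are SB&F but not B&F. -/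

import Mathlib

universe u v w

/-! ## Labels -/

/-- Visible labels: names `a` and co-names `ā`. -/
inductive Vis (N : Type u) : Type u
  | name : N → Vis N
  | coname : N → Vis N

namespace Vis

/-- The complement of a visible label. -/
def co {N : Type u} : Vis N → Vis N
  | name a => coname a
  | coname a => name a

/-- The name underlying a visible label. -/
def base {N : Type u} : Vis N → N
  | name a => a
  | coname a => a

/-- Renaming of a visible label. -/
def map {N : Type u} (s : N → N) : Vis N → Vis N
  | name a => name (s a)
  | coname a => coname (s a)

end Vis

/-- Labels: visible labels and the silent label `τ`. -/
inductive Lab (N : Type u) : Type u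
  | vis : Vis N → Lab N
  | tau : Lab N

/-! ## CCS processes (without recursion) -/

mutual

/-- CCS processes: parallel composition, finite guarded sums, restriction. -/
inductive CCS (N : Type u) : Type u
  | par : CCS N → CCS N → CCS N
  | sum : Guarded N → CCS N
  | res : CCS N → N → CCS N

/-- Finite guarded sums `λ₁.P₁ + ⋯ + λₙ.Pₙ`; `cons l P Q` is `l.P + Q`. -/
inductive Guarded (N : Type u) : Type u
  | nil : Guarded N
  | cons : Vis N → CCS N → Guarded N → Guarded N

end

mutual

/-- All names (of names and co-names, free or bound) that occur in a process. -/
def CCS.names {N : Type u} : CCS N → Set N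
  | .par P Q => P.names ∪ Q.names
  | .sum G => G.names
  | .res P a => P.names ∪ {a}

def Guarded.names {N : Type u} : Guarded N → Set N
  | .nil => ∅
  | .cons l P Q => {l.base} ∪ P.names ∪ Q.names

end

mutual

/-- The free names of a process; `P \ a` binds `a` in `P`. -/
def CCS.freeNames {N : Type u} : CCS N → Set N
  | .par P Q => P.freeNames ∪ Q.freeNames
  | .sum G => G.freeNames
  | .res P a => P.freeNames \ {a}

def Guarded.freeNames {N : Type u} : Guarded N → Set N
  | .nil => ∅
  | .cons l P Q => {l.base} ∪ P.freeNames ∪ Q.freeNames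

end

mutual

/-- Apply a map to every name, free or bound (only used with transpositions). -/
def CCS.rename {N : Type u} (s : N → N) : CCS N → CCS N
  | .par P Q => .par (P.rename s) (Q.rename s)
  | .sum G => .sum (G.rename s)
  | .res P a => .res (P.rename s) (s a)

def Guarded.rename {N : Type u} (s : N → N) : Guarded N → Guarded N
  | .nil => .nil
  | .cons l P Q => .cons (l.map s) (P.rename s) (Q.rename s)

end

namespace CCS

/-- The inactive process `0`, the empty sum. -/
def zero {N : Type u} : CCS N := .sum .nil

/-- The prefixed process `l.P`, the sum with one summand. -/
def pre {N : Type u} (l : Vis N) (P : CCS N) : CCS N := .sum (.cons l P .nil)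

/-- The structural congruence of CCS: the least congruence that contains α-conversion and in which
sums are unordered, `∣` is a commutative monoid with unit `0`, and the usual laws of restriction
hold. In `alpha`, exchanging `a` and `b` in `P` is the renaming of `a` into `b`, since `b` is not
free in `P`. -/
inductive Congr {N : Type u} [DecidableEq N] : CCS N → CCS N → Prop
  | refl (P : CCS N) : Congr P P
  | symm {P Q : CCS N} : Congr P Q → Congr Q P
  | trans {P Q R : CCS N} : Congr P Q → Congr Q R → Congr P R
  | par {P P' Q Q' : CCS N} : Congr P P' → Congr Q Q' → Congr (.par P Q) (.par P' Q')
  | res {P P' : CCS N} (a : N) : Congr P P' → Congr (.res P a) (.res P' a)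
  | head {P P' : CCS N} (l : Vis N) (Q : Guarded N) :
      Congr P P' → Congr (.sum (.cons l P Q)) (.sum (.cons l P' Q))
  | tail {Q Q' : Guarded N} (l : Vis N) (P : CCS N) :
      Congr (.sum Q) (.sum Q') → Congr (.sum (.cons l P Q)) (.sum (.cons l P Q'))
  | alpha (P : CCS N) (a b : N) :
      b ∉ P.freeNames → Congr (.res P a) (.res (P.rename (Equiv.swap a b)) b)
  | sumComm (l₁ l₂ : Vis N) (P₁ P₂ : CCS N) (Q : Guarded N) :
      Congr (.sum (.cons l₁ P₁ (.cons l₂ P₂ Q))) (.sum (.cons l₂ P₂ (.cons l₁ P₁ Q)))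
  | parComm (P Q : CCS N) : Congr (.par P Q) (.par Q P)
  | parAssoc (P Q R : CCS N) : Congr (.par (.par P Q) R) (.par P (.par Q R))
  | parZero (P : CCS N) : Congr (.par P zero) P
  | resComm (P : CCS N) (a b : N) : Congr (.res (.res P a) b) (.res (.res P b) a)
  | resZero (a : N) : Congr (.res zero a) zero
  | resPar (P Q : CCS N) (a : N) :
      a ∉ P.freeNames → Congr (.res (.par P Q) a) (.par P (.res Q a))

end CCS

/-! ## RCCS: reversible processes -/

/-- Memory stacks: `fork m` is `⋎.m` and `push i l Q m` is `⟨i, l, Q⟩.m`.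
Identifiers are natural numbers. -/
inductive Mem (N : Type u) : Type u
  | empty : Mem N
  | fork : Mem N → Mem N
  | push : ℕ → Vis N → CCS N → Mem N → Mem N

namespace Mem

/-- The identifiers that occur in a memory stack. -/
def ids {N : Type u} : Mem N → Set ℕ
  | empty => ∅
  | fork m => m.ids
  | push i _ _ m => {i} ∪ m.ids

/-- The names that occur in a memory stack (as name or as co-name, also in the stored processes). -/
def names {N : Type u} : Mem N → Set N
  | empty => ∅
  | fork m => m.names
  | push _ l Q m => {l.base} ∪ Q.names ∪ m.names

end Mem

/-- Reversible processes; `thread m P` is `m ▷ P`. -/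
inductive RCCS (N : Type u) : Type u
  | thread : Mem N → CCS N → RCCS N
  | par : RCCS N → RCCS N → RCCS N
  | res : RCCS N → N → RCCS N

/-- The direction of a transition. -/
inductive Dir : Type
  | fwd
  | bwd

namespace RCCS

/-- The identifiers that occur in a reversible process. -/
def ids {N : Type u} : RCCS N → Set ℕ
  | thread m _ => m.ids
  | par R S => R.ids ∪ S.ids
  | res R _ => R.ids

/-- The reversible process `∅ ▷ P`. -/
def start {N : Type u} (P : CCS N) : RCCS N := thread .empty P

/-- Structural equivalence of reversible processes (the underlying CCS processes are taken up to
the structural congruence of CCS, in particular up to α-conversion). -/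
inductive Congr {N : Type u} [DecidableEq N] : RCCS N → RCCS N → Prop
  | refl (R : RCCS N) : Congr R R
  | symm {R S : RCCS N} : Congr R S → Congr S R
  | trans {R S T : RCCS N} : Congr R S → Congr S T → Congr R T
  | par {R R' S S' : RCCS N} : Congr R R' → Congr S S' → Congr (.par R S) (.par R' S')
  | res {R R' : RCCS N} (a : N) : Congr R R' → Congr (.res R a) (.res R' a)
  | thread {P Q : CCS N} (m : Mem N) : CCS.Congr P Q → Congr (.thread m P) (.thread m Q)
  | distrib (m : Mem N) (P Q : CCS N) :
      Congr (.thread m (.par P Q)) (.par (.thread (.fork m) P) (.thread (.fork m) Q))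
  | scope (m : Mem N) (P : CCS N) (a : N) :
      a ∉ m.names → Congr (.thread m (.res P a)) (.res (.thread m P) a)

/-- The transitions of RCCS. `Step .fwd R i α S` is the forward transition from `R` to `S` with
identifier `i` and label `α`; `Step .bwd R i α S` is the backward transition from `R` to `S`. -/
inductive Step {N : Type u} [DecidableEq N] : Dir → RCCS N → ℕ → Lab N → RCCS N → Prop
  | act (m : Mem N) (i : ℕ) (l : Vis N) (P : CCS N) (Q : Guarded N) : i ∉ m.ids →
      Step .fwd (.thread m (.sum (.cons l P Q))) i (.vis l) (.thread (.push i l (.sum Q) m) P)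
  | actRev (m : Mem N) (i : ℕ) (l : Vis N) (P : CCS N) (Q : Guarded N) : i ∉ m.ids →
      Step .bwd (.thread (.push i l (.sum Q) m) P) i (.vis l) (.thread m (.sum (.cons l P Q)))
  | syn {d : Dir} {R R' S S' : RCCS N} {i : ℕ} {l : Vis N} :
      Step d R i (.vis l) R' → Step d S i (.vis l.co) S' →
      Step d (.par R S) i .tau (.par R' S')
  | parL {d : Dir} {R R' : RCCS N} {i : ℕ} {α : Lab N} (S : RCCS N) :
      Step d R i α R' → i ∉ S.ids → Step d (.par R S) i α (.par R' S)
  | parR {d : Dir} {S S' : RCCS N} {i : ℕ} {α : Lab N} (R : RCCS N) :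
      Step d S i α S' → i ∉ R.ids → Step d (.par R S) i α (.par R S')
  | res {d : Dir} {R R' : RCCS N} {i : ℕ} {α : Lab N} (a : N) :
      Step d R i α R' → α ≠ .vis (.name a) → α ≠ .vis (.coname a) →
      Step d (.res R a) i α (.res R' a)
  | congr {d : Dir} {R₁ R R' R₁' : RCCS N} {i : ℕ} {α : Lab N} :
      Congr R₁ R → Step d R i α R' → Congr R' R₁' → Step d R₁ i α R₁'

/-- `R` is reachable, with origin `P`: it is obtained from `∅ ▷ P` by forward and backward
transitions (and structural equivalence). -/
def IsOrigin {N : Type u} [DecidableEq N] (P : CCS N) (R : RCCS N) : Prop :=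
  Relation.ReflTransGen (fun S T => Congr S T ∨ ∃ d i α, Step d S i α T) (start P) R

/-! ## Back-and-forth bisimulations -/

/-- The partial function `f` on identifiers is a bijection between `A` and `B`. -/
def IsBijBetween (f : ℕ → Option ℕ) (A B : Set ℕ) : Prop :=
  (∀ i, i ∈ A ↔ ∃ j, f i = some j) ∧ (∀ j, j ∈ B ↔ ∃ i, f i = some j) ∧
    ∀ i i' j, f i = some j → f i' = some j → i = i'

/-- `Rel` is a back-and-forth bisimulation (B&F) between processes with origins `O₁` and `O₂`.
`Function.update f i (some j)` is `f ∪ {i ↦ j}` and `Function.update f i none` is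
`f \ {i ↦ j}` when `f i = some j`. -/
structure IsBF {N : Type u} [DecidableEq N] (O₁ O₂ : CCS N)
    (Rel : RCCS N → RCCS N → (ℕ → Option ℕ) → Prop) : Prop where
  start : Rel (start O₁) (start O₂) (fun _ => none)
  bij : ∀ R₁ R₂ f, Rel R₁ R₂ f → IsBijBetween f R₁.ids R₂.ids
  forth₁ : ∀ R₁ R₂ f, Rel R₁ R₂ f → ∀ i α S₁, Step .fwd R₁ i α S₁ →
    ∃ j S₂, Step .fwd R₂ j α S₂ ∧ Rel S₁ S₂ (Function.update f i (some j))
  forth₂ : ∀ R₁ R₂ f, Rel R₁ R₂ f → ∀ j α S₂, Step .fwd R₂ j α S₂ →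
    ∃ i S₁, Step .fwd R₁ i α S₁ ∧ Rel S₁ S₂ (Function.update f i (some j))
  back₁ : ∀ R₁ R₂ f, Rel R₁ R₂ f → ∀ i α S₁, Step .bwd R₁ i α S₁ →
    ∃ j S₂, Step .bwd R₂ j α S₂ ∧ f i = some j ∧ Rel S₁ S₂ (Function.update f i none)
  back₂ : ∀ R₁ R₂ f, Rel R₁ R₂ f → ∀ j α S₂, Step .bwd R₂ j α S₂ →
    ∃ i S₁, Step .bwd R₁ i α S₁ ∧ f i = some j ∧ Rel S₁ S₂ (Function.update f i none)

/-- `Rel` is a simple back-and-forth bisimulation (SB&F) between processes with origins `O₁` and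
`O₂`: as B&F, without the bijection on identifiers. -/
structure IsSBF {N : Type u} [DecidableEq N] (O₁ O₂ : CCS N)
    (Rel : RCCS N → RCCS N → Prop) : Prop where
  start : Rel (start O₁) (start O₂)
  forth₁ : ∀ R₁ R₂, Rel R₁ R₂ → ∀ i α S₁, Step .fwd R₁ i α S₁ →
    ∃ j S₂, Step .fwd R₂ j α S₂ ∧ Rel S₁ S₂
  forth₂ : ∀ R₁ R₂, Rel R₁ R₂ → ∀ j α S₂, Step .fwd R₂ j α S₂ →
    ∃ i S₁, Step .fwd R₁ i α S₁ ∧ Rel S₁ S₂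
  back₁ : ∀ R₁ R₂, Rel R₁ R₂ → ∀ i α S₁, Step .bwd R₁ i α S₁ →
    ∃ j S₂, Step .bwd R₂ j α S₂ ∧ Rel S₁ S₂
  back₂ : ∀ R₁ R₂, Rel R₁ R₂ → ∀ j α S₂, Step .bwd R₂ j α S₂ →
    ∃ i S₁, Step .bwd R₁ i α S₁ ∧ Rel S₁ S₂

/-- Processes with origins `O₁` and `O₂` are B&F. -/
def BF {N : Type u} [DecidableEq N] (O₁ O₂ : CCS N) : Prop :=
  ∃ Rel, IsBF O₁ O₂ Rel

/-- Processes with origins `O₁` and `O₂` are SB&F. -/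
def SBF {N : Type u} [DecidableEq N] (O₁ O₂ : CCS N) : Prop :=
  ∃ Rel, IsSBF O₁ O₂ Rel

end RCCS

/-! ## Configuration structures and the encoding of CCS -/

/-- The data of a configuration structure: events, configurations, labelling. Only the
structures that the encoding below builds by the operations on configuration structures occur. -/
structure ConfStr (L : Type u) where
  /-- the events -/
  E : Type v
  /-- the configurations -/
  C : Set (Set E)
  /-- the labelling function -/
  lab : E → L

/-- The partial product `A ×⋆ B`: the pairs `(a, ⋆)`, `(⋆, b)` and `(a, b)`. -/
inductive PartialProd (A : Type u) (B : Type v) : Type (max u v)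
  | left : A → PartialProd A B
  | right : B → PartialProd A B
  | both : A → B → PartialProd A B

namespace PartialProd

/-- First projection, `none` standing for `⋆`. -/
def fst {A : Type u} {B : Type v} : PartialProd A B → Option A
  | left a => some a
  | right _ => none
  | both a _ => some a

/-- Second projection, `none` standing for `⋆`. -/
def snd {A : Type u} {B : Type v} : PartialProd A B → Option B
  | left _ => none
  | right b => some b
  | both _ b => some b

/-- The map of partial products induced by two maps. -/
def map {A A' : Type*} {B B' : Type*} (f : A → A') (g : B → B') :
    PartialProd A B → PartialProd A' B'
  | left a => left (f a)
  | right b => right (g b)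
  | both a b => both (f a) (g b)

end PartialProd

namespace ConfStr

/-- The structure `𝟎`, without events and with the empty configuration only. -/
def zero {L : Type u} : ConfStr.{u, v} L where
  E := PEmpty
  C := {∅}
  lab := PEmpty.elim

/-- Prefixing by the label `l`; the new event is `none`. -/
def pre {L : Type u} (l : L) (A : ConfStr.{u, v} L) : ConfStr.{u, v} L where
  E := Option A.E
  C := {x | x = ∅ ∨ ∃ y ∈ A.C, x = insert none (some '' y)}
  lab := fun e => e.elim l A.lab

/-- Nondeterministic choice. -/
def choice {L : Type u} (A B : ConfStr.{u, v} L) : ConfStr.{u, v} L where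
  E := A.E ⊕ B.E
  C := {x | (∃ y ∈ A.C, x = Sum.inl '' y) ∨ ∃ y ∈ B.C, x = Sum.inr '' y}
  lab := Sum.elim A.lab B.lab

/-- Relabelling. -/
def relabel {L : Type u} {L' : Type w} (A : ConfStr.{u, v} L) (lab' : A.E → L') :
    ConfStr.{w, v} L' where
  E := A.E
  C := A.C
  lab := lab'

/-- Restriction: removal of a set `X` of events. -/
def restrict {L : Type u} (A : ConfStr.{u, v} L) (X : Set A.E) : ConfStr.{u, v} L where
  E := {e : A.E // e ∉ X}
  C := {x | Subtype.val '' x ∈ A.C}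
  lab := fun e => A.lab e.1

/-- Restriction of a set `K` of labels. -/
def restrictLabels {L : Type u} (A : ConfStr.{u, v} L) (K : Set L) : ConfStr.{u, v} L :=
  A.restrict {e | A.lab e ∈ K}

/-- Restriction of the label `⊥`, here `none`, in a structure with labels in `L ∪ {⊥}`. -/
def restrictBot {L : Type u} (A : ConfStr.{u, v} (Option L)) : ConfStr.{u, v} L :=
  let A' := A.restrictLabels {none}
  A'.relabel fun e => (A'.lab e).get (Option.isSome_iff_ne_none.mpr e.2)

/-- First projection of a set of events of the product. -/
def proj₁ {A B : Type*} (x : Set (PartialProd A B)) : Set A :=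
  {a | ∃ e ∈ x, e.fst = some a}

/-- Second projection of a set of events of the product. -/
def proj₂ {A B : Type*} (x : Set (PartialProd A B)) : Set B :=
  {b | ∃ e ∈ x, e.snd = some b}

/-- Product of configuration structures. -/
def product {L L' : Type u} (A : ConfStr.{u, v} L) (B : ConfStr.{u, v} L') :
    ConfStr.{u, v} (PartialProd L L') where
  E := PartialProd A.E B.E
  C := {x | proj₁ x ∈ A.C ∧ proj₂ x ∈ B.C ∧
    (∀ e ∈ x, ∀ e' ∈ x, ((e.fst = e'.fst ∧ e.fst ≠ none) ∨ (e.snd = e'.snd ∧ e.snd ≠ none)) →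
      e = e') ∧
    (∀ e ∈ x, ∃ z ⊆ x, z.Finite ∧ proj₁ z ∈ A.C ∧ proj₂ z ∈ B.C ∧ e ∈ z) ∧
    (∀ e ∈ x, ∀ e' ∈ x, e ≠ e' →
      ∃ z ⊆ x, proj₁ z ∈ A.C ∧ proj₂ z ∈ B.C ∧ (e ∈ z ↔ e' ∉ z))}
  lab := PartialProd.map A.lab B.lab

open Classical in
/-- The synchronization algebra of CCS, with `none` for `⊥`: `⋆` is the identity, complementary
visible labels synchronize into `τ`, nothing else synchronizes. -/
noncomputable def sync {N : Type u} : PartialProd (Lab N) (Lab N) → Option (Lab N)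
  | .left α => some α
  | .right β => some β
  | .both (.vis l) (.vis l') => if l' = l.co then some .tau else none
  | .both _ _ => none

/-- Parallel composition. -/
noncomputable def par {N : Type u} (A B : ConfStr.{u, v} (Lab N)) : ConfStr.{u, v} (Lab N) :=
  ((A.product B).relabel fun e => sync ((A.product B).lab e)).restrictBot

/-- Causality `d ≤ₓ e` on a configuration `x`. -/
def le {L : Type u} (A : ConfStr.{u, v} L) (x : Set A.E) (d e : A.E) : Prop :=
  ∀ y ∈ A.C, y ⊆ x → e ∈ y → d ∈ y

/-- Strict causality `d <ₓ e`. -/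
def lt {L : Type u} (A : ConfStr.{u, v} L) (x : Set A.E) (d e : A.E) : Prop :=
  A.le x d e ∧ d ≠ e

/-- Concurrency `d coₓ e`. -/
def Conc {L : Type u} (A : ConfStr.{u, v} L) (x : Set A.E) (d e : A.E) : Prop :=
  ¬ (A.lt x d e ∨ A.lt x e d)

/-- Absence of auto-concurrency. -/
def WithoutAutoConcurrency {L : Type u} (A : ConfStr.{u, v} L) : Prop :=
  ∀ x ∈ A.C, ∀ e₁ ∈ x, ∀ e₂ ∈ x, A.Conc x e₁ e₂ → A.lab e₁ = A.lab e₂ → e₁ = e₂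

end ConfStr

mutual

/-- The encoding of CCS processes as configuration structures. -/
noncomputable def CCS.encode {N : Type u} : CCS N → ConfStr.{u, 0} (Lab N)
  | .par P Q => ConfStr.par P.encode Q.encode
  | .sum G => G.encode
  | .res P a => P.encode.restrictLabels {.vis (.name a), .vis (.coname a)}

/-- The encoding of guarded sums (`𝟎` is neutral for the choice, up to isomorphism). -/
noncomputable def Guarded.encode {N : Type u} : Guarded N → ConfStr.{u, 0} (Lab N)
  | .nil => ConfStr.zero
  | .cons l P Q => ConfStr.choice (ConfStr.pre (.vis l) P.encode) Q.encode

end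

/-!
Without auto-concurrency the events with a given label are totally ordered by causality in every
configuration, so a process can only undo the last of its events with that label. A simple
back-and-forth bisimulation therefore matches, along any two related computations, the `n`-th event
labelled `α` on one side with the `n`-th event labelled `α` on the other side. This matching is
determined by the two computations. Refining the relation by it (`RCCS.Lift`) gives a
back-and-forth bisimulation (`RCCS.IsSBF.isBF_lift`): a forward transition appends a new last event
on both sides, and a backward transition removes the last event on both sides. For a pair of
processes other than the origins, `RCCS.IsSBF.exists_matches` finds the matching by undoing a
computation of the first process and following it on the other side.

Structural equivalence makes it awkward to reason on reversible processes themselves, for instance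
to show that independent backward transitions commute. The intermediate notion is that of a keyed
process (`Keyed`), a CCS process whose executed prefixes stay in place, marked by the identifier of
their execution. Transitions of keyed processes (`Keyed.Tr`) are purely structural, and

* backward transitions with different keys commute (`Keyed.Tr.bwd_diamond`), so a process that is
  reachable at all is reachable by forward transitions only (`Keyed.Run.bwd`);
* structural congruence of keyed processes is a bisimulation (`Keyed.Congr.sub`);
* reversible processes and the keyed processes they represent (`RCCS.Rep`) have the same
  transitions, up to this congruence (`RCCS.Step.tr` and `RCCS.Rep.realizes`);
* the executed prefixes of a keyed process reachable from `P` form a configuration of the encoding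
  of `P`, and a transition adds one event to it (`CCS.exists_model`). Two events that can be undone
  in the same state are concurrent, so without auto-concurrency they have different labels
  (`ConfStr.WithoutAutoConcurrency.key_unique`).

The processes `a ∣ a` and `a.a` have the same states when only the number of executed actions
counts, which gives a simple back-and-forth bisimulation. After both actions, `a ∣ a` can undo the
first one and `a.a` cannot, so a back-and-forth bisimulation does not exist.
-/

/-! ### Keyed processes -/

/-- Keyed processes: CCS processes in which an executed prefix is not removed but marked with the
identifier (key) of its execution. `cons l P Q` is the sum `l.P + Q` whose summand `l.P` is not
executed, `fired i l X Q` is the sum `l.P + Q` whose summand `l.P` was executed with key `i` and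
continued to `X`. Processes and guarded sums share one type. -/
inductive Keyed (N : Type u) : Type u
  | nil : Keyed N
  | cons : Vis N → Keyed N → Keyed N → Keyed N
  | fired : ℕ → Vis N → Keyed N → Keyed N → Keyed N
  | par : Keyed N → Keyed N → Keyed N
  | res : Keyed N → N → Keyed N

/-- The opposite direction. -/
def Dir.flip : Dir → Dir
  | .fwd => .bwd
  | .bwd => .fwd

/-- Renaming of a label. -/
def Lab.map {N : Type u} (s : N → N) : Lab N → Lab N
  | .vis l => .vis (l.map s)
  | .tau => .tau

namespace Vis

variable {N : Type u}

@[simp] theorem co_co (l : Vis N) : l.co.co = l := by cases l <;> rfl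

@[simp] theorem base_co (l : Vis N) : l.co.base = l.base := by cases l <;> rfl

@[simp] theorem base_map (s : N → N) (l : Vis N) : (l.map s).base = s l.base := by cases l <;> rfl

theorem map_co (s : N → N) (l : Vis N) : l.co.map s = (l.map s).co := by cases l <;> rfl

theorem map_map (s t : N → N) (l : Vis N) : (l.map s).map t = l.map (t ∘ s) := by cases l <;> rfl

theorem map_id (l : Vis N) : l.map id = l := by cases l <;> rfl

theorem map_eq_self {s : N → N} {l : Vis N} (h : s l.base = l.base) : l.map s = l := by
  cases l <;> simp_all [Vis.map, Vis.base]

theorem ne_of_ne_base {l : Vis N} {a : N} (h : a ≠ l.base) :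
    Lab.vis l ≠ .vis (.name a) ∧ Lab.vis l ≠ .vis (.coname a) := by
  constructor <;> · rintro ⟨⟩; exact h rfl

end Vis

namespace Keyed

variable {N : Type u}

/-- The keys of the executed prefixes. -/
def keys : Keyed N → Set ℕ
  | nil => ∅
  | cons _ P Q => P.keys ∪ Q.keys
  | fired i _ X Q => insert i (X.keys ∪ Q.keys)
  | par K L => K.keys ∪ L.keys
  | res K _ => K.keys

/-- The free names of a keyed process, those of its executed prefixes included. -/
def freeNames : Keyed N → Set N
  | nil => ∅
  | cons l P Q => {l.base} ∪ P.freeNames ∪ Q.freeNames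
  | fired _ l X Q => {l.base} ∪ X.freeNames ∪ Q.freeNames
  | par K L => K.freeNames ∪ L.freeNames
  | res K a => K.freeNames \ {a}

/-- Apply a map to every name, free or bound. -/
def rename (s : N → N) : Keyed N → Keyed N
  | nil => nil
  | cons l P Q => cons (l.map s) (P.rename s) (Q.rename s)
  | fired i l X Q => fired i (l.map s) (X.rename s) (Q.rename s)
  | par K L => par (K.rename s) (L.rename s)
  | res K a => res (K.rename s) (s a)

/-- The number of constructors, a measure for inductions that rename along the way. -/
def size : Keyed N → ℕ
  | nil => 0
  | cons _ P Q => P.size + Q.size + 1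
  | fired _ _ X Q => X.size + Q.size + 1
  | par K L => K.size + L.size + 1
  | res K _ => K.size + 1

/-- The transitions of keyed processes, in both directions. Only processes without keys may stand
in summands that are not executed, so that a sum executes at most one summand. -/
inductive Tr : Dir → Keyed N → ℕ → Lab N → Keyed N → Prop
  | fire {i : ℕ} {l : Vis N} {P Q : Keyed N} : P.keys = ∅ → Q.keys = ∅ →
      Tr .fwd (cons l P Q) i (.vis l) (fired i l P Q)
  | unfire {i : ℕ} {l : Vis N} {P Q : Keyed N} : P.keys = ∅ → Q.keys = ∅ →
      Tr .bwd (fired i l P Q) i (.vis l) (cons l P Q)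
  | rest {d : Dir} {i : ℕ} {α : Lab N} {l : Vis N} {P Q Q' : Keyed N} : P.keys = ∅ →
      Tr d Q i α Q' → Tr d (cons l P Q) i α (cons l P Q')
  | under {d : Dir} {i j : ℕ} {α : Lab N} {l : Vis N} {X X' Q : Keyed N} : Q.keys = ∅ → i ≠ j →
      Tr d X i α X' → Tr d (fired j l X Q) i α (fired j l X' Q)
  | syn {d : Dir} {i : ℕ} {l : Vis N} {K K' L L' : Keyed N} :
      Tr d K i (.vis l) K' → Tr d L i (.vis l.co) L' → Tr d (par K L) i .tau (par K' L')
  | parL {d : Dir} {i : ℕ} {α : Lab N} {K K' L : Keyed N} :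
      Tr d K i α K' → i ∉ L.keys → Tr d (par K L) i α (par K' L)
  | parR {d : Dir} {i : ℕ} {α : Lab N} {K L L' : Keyed N} :
      Tr d L i α L' → i ∉ K.keys → Tr d (par K L) i α (par K L')
  | res {d : Dir} {i : ℕ} {α : Lab N} {a : N} {K K' : Keyed N} :
      Tr d K i α K' → α ≠ .vis (.name a) → α ≠ .vis (.coname a) →
      Tr d (res K a) i α (res K' a)

theorem Tr.flip {d : Dir} {K K' : Keyed N} {i : ℕ} {α : Lab N} (h : Tr d K i α K') :
    Tr d.flip K' i α K := by
  induction h with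
  | fire h₁ h₂ => exact .unfire h₁ h₂
  | unfire h₁ h₂ => exact .fire h₁ h₂
  | rest h₁ _ ih => exact .rest h₁ ih
  | under h₁ h₂ _ ih => exact .under h₁ h₂ ih
  | syn _ _ ih₁ ih₂ => exact .syn ih₁ ih₂
  | parL _ h ih => exact .parL ih h
  | parR _ h ih => exact .parR ih h
  | res _ h₁ h₂ ih => exact .res ih h₁ h₂

theorem tr_bwd_iff {K K' : Keyed N} {i : ℕ} {α : Lab N} : Tr .bwd K i α K' ↔ Tr .fwd K' i α K :=
  ⟨Tr.flip, Tr.flip⟩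

theorem Tr.keys_fwd {K K' : Keyed N} {i : ℕ} {α : Lab N} (h : Tr .fwd K i α K') :
    i ∉ K.keys ∧ K'.keys = insert i K.keys := by
  generalize hd : Dir.fwd = d at h
  induction h with
  | fire h₁ h₂ => simp [keys, h₁, h₂]
  | unfire h₁ h₂ => cases hd
  | rest h₁ _ ih => simp [keys, h₁, ih hd]
  | under h₁ h₂ _ ih => simp [keys, h₁, h₂, ih hd, Set.insert_comm]
  | syn _ _ ih₁ ih₂ =>
    simp only [keys, ih₁ hd, ih₂ hd, Set.mem_union, not_or, not_false_eq_true, and_self, true_and]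
    simp [Set.insert_union, Set.union_insert]
  | parL _ h ih => simp [keys, ih hd, h, Set.insert_union]
  | parR _ h ih => simp [keys, ih hd, h, Set.union_insert]
  | res _ h₁ h₂ ih => exact ih hd

theorem Tr.keys_bwd {K K' : Keyed N} {i : ℕ} {α : Lab N} (h : Tr .bwd K i α K') :
    i ∉ K'.keys ∧ K.keys = insert i K'.keys :=
  (tr_bwd_iff.1 h).keys_fwd

theorem Tr.mem_keys_of_bwd {K K' : Keyed N} {i : ℕ} {α : Lab N} (h : Tr .bwd K i α K') :
    i ∈ K.keys := by
  simp [h.keys_bwd]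

/-- A transition changes only the presence of its own key. -/
theorem Tr.mem_keys_iff {d : Dir} {K K' : Keyed N} {i j : ℕ} {α : Lab N} (h : Tr d K i α K')
    (hj : j ≠ i) : j ∈ K'.keys ↔ j ∈ K.keys := by
  cases d
  · simp [h.keys_fwd, hj]
  · simp [h.keys_bwd, hj]

theorem Tr.freeNames_eq {d : Dir} {K K' : Keyed N} {i : ℕ} {α : Lab N} (h : Tr d K i α K') :
    K'.freeNames = K.freeNames := by
  induction h <;> simp_all [freeNames]

theorem Tr.base_mem {d : Dir} {K K' : Keyed N} {i : ℕ} {l : Vis N} (h : Tr d K i (.vis l) K') :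
    l.base ∈ K.freeNames := by
  generalize hα : Lab.vis l = α at h
  induction h with
  | res _ h₁ h₂ ih =>
    refine ⟨ih hα, ?_⟩
    rintro rfl
    subst hα
    cases l <;> simp_all [Vis.base]
  | _ => simp_all [freeNames]

theorem tr_label_ne {d : Dir} {K K' : Keyed N} {i : ℕ} {α : Lab N} {a : N} (h : Tr d K i α K')
    (ha : a ∉ K.freeNames) : α ≠ .vis (.name a) ∧ α ≠ .vis (.coname a) := by
  constructor <;> · rintro rfl; exact ha h.base_mem

@[simp] theorem keys_rename (s : N → N) (K : Keyed N) : (K.rename s).keys = K.keys := by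
  induction K <;> simp_all [rename, keys]

@[simp] theorem size_rename (s : N → N) (K : Keyed N) : (K.rename s).size = K.size := by
  induction K <;> simp_all [rename, size]

theorem rename_rename (s t : N → N) (K : Keyed N) :
    (K.rename s).rename t = K.rename (t ∘ s) := by
  induction K <;> simp_all [rename, Vis.map_map]

theorem rename_id (K : Keyed N) : K.rename id = K := by
  induction K <;> simp_all [rename, Vis.map_id]

theorem freeNames_rename (s : N ≃ N) (K : Keyed N) :
    (K.rename s).freeNames = s '' K.freeNames := by
  induction K with
  | res K a ih => simp [rename, freeNames, ih, Set.image_sdiff s.injective]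
  | _ => simp_all [rename, freeNames, Set.image_union, Set.image_insert_eq]

theorem Tr.rename (s : N ≃ N) {d : Dir} {K K' : Keyed N} {i : ℕ} {α : Lab N} (h : Tr d K i α K') :
    Tr d (K.rename s) i (α.map s) (K'.rename s) := by
  induction h with
  | fire h₁ h₂ => exact .fire (by simpa using h₁) (by simpa using h₂)
  | unfire h₁ h₂ => exact .unfire (by simpa using h₁) (by simpa using h₂)
  | rest h₁ _ ih => exact .rest (by simpa using h₁) ih
  | under h₁ h₂ _ ih => exact .under (by simpa using h₁) h₂ ih
  | syn _ _ ih₁ ih₂ => exact .syn ih₁ (by simpa [Lab.map, Vis.map_co] using ih₂)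
  | parL _ h ih => exact .parL ih (by simpa using h)
  | parR _ h ih => exact .parR ih (by simpa using h)
  | @res d i α a K K' _ h₁ h₂ ih =>
    refine .res ih ?_ ?_
    · intro h
      cases α with
      | tau => cases h
      | vis l =>
        cases l <;> simp_all [Lab.map, Vis.map]
    · intro h
      cases α with
      | tau => cases h
      | vis l =>
        cases l <;> simp_all [Lab.map, Vis.map]

/-- Backward transitions are deterministic for a given key and commute for different keys. -/
theorem Tr.bwd_diamond {K K₀ K₁ : Keyed N} {i k : ℕ} {α β : Lab N} (h₀ : Tr .bwd K i α K₀)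
    (h₁ : Tr .bwd K k β K₁) :
    (i = k ∧ α = β ∧ K₀ = K₁) ∨ (i ≠ k ∧ ∃ K₂, Tr .bwd K₀ k β K₂ ∧ Tr .bwd K₁ i α K₂) := by
  generalize hd : Dir.bwd = d at h₀
  induction h₀ generalizing k β K₁ with
  | fire => cases hd
  | unfire hP hQ =>
    cases h₁ with
    | unfire => simp
    | under _ _ h => simpa [hP] using h.mem_keys_of_bwd
  | rest hP h ih =>
    cases h₁ with
    | rest _ h' =>
      rcases ih h' hd with ⟨rfl, rfl, rfl⟩ | ⟨hne, K₂, h₂, h₃⟩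
      · simp
      · exact .inr ⟨hne, _, .rest hP h₂, .rest hP h₃⟩
  | under hQ hij h ih =>
    subst hd
    cases h₁ with
    | unfire hP => simpa [hP] using h.mem_keys_of_bwd
    | under _ hkj h' =>
      rcases ih h' rfl with ⟨rfl, rfl, rfl⟩ | ⟨hne, K₂, h₂, h₃⟩
      · simp
      · exact .inr ⟨hne, _, .under hQ hkj h₂, .under hQ hij h₃⟩
  | @syn d i l K K' L L' hK hL ihK ihL =>
    subst hd
    cases h₁ with
    | syn hK' hL' =>
      rcases ihK hK' rfl with ⟨rfl, hl, rfl⟩ | ⟨hne, K₂, h₂, h₃⟩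
      · cases hl
        rcases ihL hL' rfl with ⟨_, _, rfl⟩ | ⟨hne, _⟩
        · simp
        · exact absurd rfl hne
      · rcases ihL hL' rfl with ⟨h, _⟩ | ⟨_, L₂, h₄, h₅⟩
        · exact absurd h hne
        · exact .inr ⟨hne, _, .syn h₂ h₄, .syn h₃ h₅⟩
    | parL hK' hk =>
      have hne : i ≠ k := by rintro rfl; exact hk hL.mem_keys_of_bwd
      rcases ihK hK' rfl with ⟨h, _⟩ | ⟨_, K₂, h₂, h₃⟩
      · exact absurd h hne
      · exact .inr ⟨hne, _, .parL h₂ (by rwa [hL.mem_keys_iff hne.symm]), .syn h₃ hL⟩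
    | parR hL' hk =>
      have hne : i ≠ k := by rintro rfl; exact hk hK.mem_keys_of_bwd
      rcases ihL hL' rfl with ⟨h, _⟩ | ⟨_, K₂, h₂, h₃⟩
      · exact absurd h hne
      · exact .inr ⟨hne, _, .parR h₂ (by rwa [hK.mem_keys_iff hne.symm]), .syn hK h₃⟩
  | @parL d i α K K' L hK hi ih =>
    subst hd
    cases h₁ with
    | syn hK' hL' =>
      have hne : i ≠ k := by rintro rfl; exact hi hL'.mem_keys_of_bwd
      rcases ih hK' rfl with ⟨h, _⟩ | ⟨_, K₂, h₂, h₃⟩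
      · exact absurd h hne
      · exact .inr ⟨hne, _, .syn h₂ hL', .parL h₃ (by rwa [hL'.mem_keys_iff hne])⟩
    | parL hK' hk =>
      rcases ih hK' rfl with ⟨rfl, rfl, rfl⟩ | ⟨hne, K₂, h₂, h₃⟩
      · simp
      · exact .inr ⟨hne, _, .parL h₂ hk, .parL h₃ hi⟩
    | parR hL' hk =>
      have hne : i ≠ k := by rintro rfl; exact hi hL'.mem_keys_of_bwd
      exact .inr ⟨hne, _, .parR hL' (by rwa [hK.mem_keys_iff hne.symm]),
        .parL hK (by rwa [hL'.mem_keys_iff hne])⟩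
  | @parR d i α K L L' hL hi ih =>
    subst hd
    cases h₁ with
    | syn hK' hL' =>
      have hne : i ≠ k := by rintro rfl; exact hi hK'.mem_keys_of_bwd
      rcases ih hL' rfl with ⟨h, _⟩ | ⟨_, K₂, h₂, h₃⟩
      · exact absurd h hne
      · exact .inr ⟨hne, _, .syn hK' h₂, .parR h₃ (by rwa [hK'.mem_keys_iff hne])⟩
    | parR hL' hk =>
      rcases ih hL' rfl with ⟨rfl, rfl, rfl⟩ | ⟨hne, K₂, h₂, h₃⟩
      · simp
      · exact .inr ⟨hne, _, .parR h₂ hk, .parR h₃ hi⟩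
    | parL hK' hk =>
      have hne : i ≠ k := by rintro rfl; exact hi hK'.mem_keys_of_bwd
      exact .inr ⟨hne, _, .parL hK' (by rwa [hL.mem_keys_iff hne.symm]),
        .parR hL (by rwa [hK'.mem_keys_iff hne])⟩
  | res h hn hc ih =>
    cases h₁ with
    | res h' hn' hc' =>
      rcases ih h' hd with ⟨rfl, rfl, rfl⟩ | ⟨hne, K₂, h₂, h₃⟩
      · simp
      · exact .inr ⟨hne, _, .res h₂ hn' hc', .res h₃ hn hc⟩

end Keyed

/-! ### Structural congruence of keyed processes -/

namespace Keyed

variable {N : Type u} [DecidableEq N]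

/-- Structural congruence of keyed processes. Apart from the laws of CCS it contains
`sumFired`, which makes sums with an executed summand unordered, and `resCons` and `resFired`,
which move a restriction under a prefix. The latter are needed because structural equivalence of
reversible processes moves a restriction across a memory. -/
inductive Congr : Keyed N → Keyed N → Prop
  | refl (K : Keyed N) : Congr K K
  | symm {K L : Keyed N} : Congr K L → Congr L K
  | trans {K L M : Keyed N} : Congr K L → Congr L M → Congr K M
  | par {K K' L L' : Keyed N} : Congr K K' → Congr L L' → Congr (.par K L) (.par K' L')
  | res {K K' : Keyed N} (a : N) : Congr K K' → Congr (.res K a) (.res K' a)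
  | cons {P P' Q Q' : Keyed N} (l : Vis N) : Congr P P' → Congr Q Q' →
      Congr (.cons l P Q) (.cons l P' Q')
  | fired {X X' Q Q' : Keyed N} (i : ℕ) (l : Vis N) : Congr X X' → Congr Q Q' →
      Congr (.fired i l X Q) (.fired i l X' Q')
  | alpha (K : Keyed N) (a b : N) : b ∉ K.freeNames →
      Congr (.res K a) (.res (K.rename (Equiv.swap a b)) b)
  | sumComm (l₁ l₂ : Vis N) (P₁ P₂ Q : Keyed N) :
      Congr (.cons l₁ P₁ (.cons l₂ P₂ Q)) (.cons l₂ P₂ (.cons l₁ P₁ Q))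
  | sumFired (i : ℕ) (l₁ l₂ : Vis N) (P X Q : Keyed N) : P.keys = ∅ →
      Congr (.cons l₁ P (.fired i l₂ X Q)) (.fired i l₂ X (.cons l₁ P Q))
  | parComm (K L : Keyed N) : Congr (.par K L) (.par L K)
  | parAssoc (K L M : Keyed N) : Congr (.par (.par K L) M) (.par K (.par L M))
  | parZero (K : Keyed N) : Congr (.par K .nil) K
  | resComm (K : Keyed N) (a b : N) : Congr (.res (.res K a) b) (.res (.res K b) a)
  | resZero (a : N) : Congr (.res .nil a) .nil
  | resPar (K L : Keyed N) (a : N) : a ∉ K.freeNames →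
      Congr (.res (.par K L) a) (.par K (.res L a))
  | resCons (l : Vis N) (P Q : Keyed N) (a : N) : a ≠ l.base → a ∉ Q.freeNames →
      Congr (.res (.cons l P Q) a) (.cons l (.res P a) Q)
  | resFired (i : ℕ) (l : Vis N) (X Q : Keyed N) (a : N) : a ≠ l.base → a ∉ Q.freeNames →
      Congr (.res (.fired i l X Q) a) (.fired i l (.res X a) Q)

theorem Congr.keys_eq {K L : Keyed N} (h : Congr K L) : K.keys = L.keys := by
  induction h with
  | symm _ ih => exact ih.symm
  | trans _ _ ih₁ ih₂ => exact ih₁.trans ih₂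
  | sumFired i l₁ l₂ P X Q hP => simp [keys, hP]
  | sumComm => simp [keys, Set.union_left_comm]
  | parComm => simp [keys, Set.union_comm]
  | parAssoc => simp [keys, Set.union_assoc]
  | _ => simp_all [keys]

/-- Every transition of `K` is matched by `L`, up to congruence. -/
def Sub (K L : Keyed N) : Prop :=
  ∀ d i α K', Tr d K i α K' → ∃ L', Tr d L i α L' ∧ Congr K' L'

theorem sub_par {K K' L L' : Keyed N} (hK : Congr K K') (hL : Congr L L') (h₁ : Sub K K')
    (h₂ : Sub L L') : Sub (.par K L) (.par K' L') := by
  intro d i α T h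
  cases h with
  | syn h h' =>
    obtain ⟨X, hX, hX'⟩ := h₁ _ _ _ _ h
    obtain ⟨Y, hY, hY'⟩ := h₂ _ _ _ _ h'
    exact ⟨_, .syn hX hY, .par hX' hY'⟩
  | parL h hi =>
    obtain ⟨X, hX, hX'⟩ := h₁ _ _ _ _ h
    exact ⟨_, .parL hX (hL.keys_eq ▸ hi), .par hX' hL⟩
  | parR h hi =>
    obtain ⟨X, hX, hX'⟩ := h₂ _ _ _ _ h
    exact ⟨_, .parR hX (hK.keys_eq ▸ hi), .par hK hX'⟩

theorem sub_res {K K' : Keyed N} (a : N) (h₁ : Sub K K') : Sub (.res K a) (.res K' a) := by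
  intro d i α T h
  cases h with
  | res h hn hc =>
    obtain ⟨X, hX, hX'⟩ := h₁ _ _ _ _ h
    exact ⟨_, .res hX hn hc, .res a hX'⟩

theorem sub_cons {P P' Q Q' : Keyed N} (l : Vis N) (hP : Congr P P') (hQ : Congr Q Q')
    (h₂ : Sub Q Q') : Sub (.cons l P Q) (.cons l P' Q') := by
  intro d i α T h
  cases h with
  | fire h h' =>
    exact ⟨_, .fire (hP.keys_eq ▸ h) (hQ.keys_eq ▸ h'), .fired _ _ hP hQ⟩
  | rest h h' =>
    obtain ⟨X, hX, hX'⟩ := h₂ _ _ _ _ h'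
    exact ⟨_, .rest (hP.keys_eq ▸ h) hX, .cons _ hP hX'⟩

theorem sub_fired {X X' Q Q' : Keyed N} (i : ℕ) (l : Vis N) (hX : Congr X X') (hQ : Congr Q Q')
    (h₁ : Sub X X') : Sub (.fired i l X Q) (.fired i l X' Q') := by
  intro d i α T h
  cases h with
  | unfire h h' =>
    exact ⟨_, .unfire (hX.keys_eq ▸ h) (hQ.keys_eq ▸ h'), .cons _ hX hQ⟩
  | under h hij h' =>
    obtain ⟨Y, hY, hY'⟩ := h₁ _ _ _ _ h'
    exact ⟨_, .under (hQ.keys_eq ▸ h) hij hY, .fired _ _ hY' hQ⟩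

theorem sub_alpha {K : Keyed N} {a b : N} (hb : b ∉ K.freeNames) :
    Sub (.res K a) (.res (K.rename (Equiv.swap a b)) b) := by
  intro d i α T h
  cases h with
  | @res _ _ _ _ _ K' h hn hc =>
    have hα : α.map (Equiv.swap a b) = α := by
      cases α with
      | tau => rfl
      | vis l =>
        refine congrArg Lab.vis (Vis.map_eq_self (Equiv.swap_apply_of_ne_of_ne ?_ ?_))
        · rintro rfl
          cases l <;> simp_all [Vis.base]
        · rintro rfl; exact hb h.base_mem
    have h' := h.rename (Equiv.swap a b)
    rw [hα] at h'
    refine ⟨_, .res h' ?_ ?_, .alpha _ _ _ (by rwa [h.freeNames_eq])⟩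
    · exact (tr_label_ne h hb).1
    · exact (tr_label_ne h hb).2

theorem rename_swap_rename_swap (K : Keyed N) (a b : N) :
    (K.rename (Equiv.swap a b)).rename (Equiv.swap b a) = K := by
  rw [rename_rename, Equiv.swap_comm b a]
  convert rename_id K
  ext x
  simp

theorem notMem_freeNames_rename_swap {K : Keyed N} {a b : N} (hb : b ∉ K.freeNames) :
    a ∉ (K.rename (Equiv.swap a b)).freeNames := by
  rw [freeNames_rename]
  rintro ⟨x, hx, hxa⟩
  rw [Equiv.swap_apply_eq_iff, Equiv.swap_apply_left] at hxa
  exact hb (hxa ▸ hx)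

theorem sub_sumComm (l₁ l₂ : Vis N) (P₁ P₂ Q : Keyed N) :
    Sub (.cons l₁ P₁ (.cons l₂ P₂ Q)) (.cons l₂ P₂ (.cons l₁ P₁ Q)) := by
  intro d i α T h
  cases h with
  | fire h h' =>
    simp only [keys, Set.union_empty_iff] at h'
    exact ⟨_, .rest h'.1 (.fire h h'.2), .symm (.sumFired _ _ _ _ _ _ h'.1)⟩
  | rest h h' =>
    cases h' with
    | fire h₁ h₂ => exact ⟨_, .fire h₁ (by simp [keys, h, h₂]), .sumFired _ _ _ _ _ _ h⟩
    | rest h₁ h₂ => exact ⟨_, .rest h₁ (.rest h h₂), .sumComm _ _ _ _ _⟩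

theorem sub_sumFired {i : ℕ} {l₁ l₂ : Vis N} {P X Q : Keyed N} (hP : P.keys = ∅) :
    Sub (.cons l₁ P (.fired i l₂ X Q)) (.fired i l₂ X (.cons l₁ P Q)) := by
  intro d i α T h
  cases h with
  | fire h h' => exact absurd h' (Set.insert_nonempty _ _).ne_empty
  | rest h h' =>
    cases h' with
    | unfire h₁ h₂ => exact ⟨_, .unfire h₁ (by simp [keys, h, h₂]), .sumComm _ _ _ _ _⟩
    | under h₁ hij h₂ =>
      exact ⟨_, .under (by simp [keys, h, h₁]) hij h₂, .sumFired _ _ _ _ _ _ hP⟩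

theorem sub_sumFired_symm {i : ℕ} {l₁ l₂ : Vis N} {P X Q : Keyed N} (hP : P.keys = ∅) :
    Sub (.fired i l₂ X (.cons l₁ P Q)) (.cons l₁ P (.fired i l₂ X Q)) := by
  intro d i α T h
  cases h with
  | unfire h h' =>
    simp only [keys, Set.union_empty_iff] at h'
    exact ⟨_, .rest hP (.unfire h h'.2), .sumComm _ _ _ _ _⟩
  | under h hij h' =>
    simp only [keys, Set.union_empty_iff] at h
    exact ⟨_, .rest hP (.under h.2 hij h'), .symm (.sumFired _ _ _ _ _ _ hP)⟩

theorem sub_parComm (K L : Keyed N) : Sub (.par K L) (.par L K) := by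
  intro d i α T h
  cases h with
  | @syn _ _ l _ _ _ _ h h' => exact ⟨_, .syn h' (by simpa using h), .parComm _ _⟩
  | parL h hi => exact ⟨_, .parR h hi, .parComm _ _⟩
  | parR h hi => exact ⟨_, .parL h hi, .parComm _ _⟩

theorem sub_parAssoc (K L M : Keyed N) : Sub (.par (.par K L) M) (.par K (.par L M)) := by
  intro d i α T h
  cases h with
  | syn h h' =>
    cases h with
    | parL h hi =>
      exact ⟨_, .syn h (.parR h' hi), .parAssoc _ _ _⟩
    | parR h hi =>
      exact ⟨_, .parR (.syn h h') hi, .parAssoc _ _ _⟩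
  | parL h hi =>
    cases h with
    | syn h h' => exact ⟨_, .syn h (.parL h' hi), .parAssoc _ _ _⟩
    | parL h hi' => exact ⟨_, .parL h (by simp_all [keys]), .parAssoc _ _ _⟩
    | parR h hi' => exact ⟨_, .parR (.parL h hi) hi', .parAssoc _ _ _⟩
  | parR h hi =>
    simp only [keys, Set.mem_union, not_or] at hi
    exact ⟨_, .parR (.parR h hi.2) hi.1, .parAssoc _ _ _⟩

theorem sub_parAssoc_symm (K L M : Keyed N) : Sub (.par K (.par L M)) (.par (.par K L) M) := by
  intro d i α T h
  cases h with
  | syn h h' =>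
    cases h' with
    | parL h' hi => exact ⟨_, .parL (.syn h h') hi, .symm (.parAssoc _ _ _)⟩
    | parR h' hi => exact ⟨_, .syn (.parL h hi) h', .symm (.parAssoc _ _ _)⟩
  | parR h hi =>
    cases h with
    | syn h h' => exact ⟨_, .syn (.parR h hi) h', .symm (.parAssoc _ _ _)⟩
    | parR h hi' => exact ⟨_, .parR h (by simp_all [keys]), .symm (.parAssoc _ _ _)⟩
    | parL h hi' => exact ⟨_, .parL (.parR h hi) hi', .symm (.parAssoc _ _ _)⟩
  | parL h hi =>
    simp only [keys, Set.mem_union, not_or] at hi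
    exact ⟨_, .parL (.parL h hi.1) hi.2, .symm (.parAssoc _ _ _)⟩

theorem sub_parZero (K : Keyed N) : Sub (.par K .nil) K := by
  intro d i α T h
  cases h with
  | syn h h' => cases h'
  | parL h hi => exact ⟨_, h, .parZero _⟩
  | parR h => cases h

theorem sub_parZero_symm (K : Keyed N) : Sub K (.par K .nil) :=
  fun _ _ _ _ h => ⟨_, .parL h (by simp [keys]), .symm (.parZero _)⟩

theorem sub_resComm (K : Keyed N) (a b : N) : Sub (.res (.res K a) b) (.res (.res K b) a) := by
  intro d i α T h
  cases h with
  | res h h₁ h₂ =>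
    cases h with
    | res h h₃ h₄ => exact ⟨_, .res (.res h h₁ h₂) h₃ h₄, .resComm _ _ _⟩

theorem sub_resPar {K L : Keyed N} {a : N} (ha : a ∉ K.freeNames) :
    Sub (.res (.par K L) a) (.par K (.res L a)) := by
  intro d i α T h
  cases h with
  | res h hn hc =>
    cases h with
    | @syn _ _ l _ _ _ _ h h' =>
      have := Vis.ne_of_ne_base (l := l.co) (a := a)
        (by rintro rfl; exact ha (by simpa using h.base_mem))
      exact ⟨_, .syn h (.res h' this.1 this.2), .resPar _ _ _ (by rwa [h.freeNames_eq])⟩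
    | parL h hi => exact ⟨_, .parL h hi, .resPar _ _ _ (by rwa [h.freeNames_eq])⟩
    | parR h hi => exact ⟨_, .parR (.res h hn hc) hi, .resPar _ _ _ ha⟩

theorem sub_resPar_symm {K L : Keyed N} {a : N} (ha : a ∉ K.freeNames) :
    Sub (.par K (.res L a)) (.res (.par K L) a) := by
  intro d i α T h
  cases h with
  | syn h h' =>
    cases h' with
    | res h' hn hc =>
      exact ⟨_, .res (.syn h h') (by simp) (by simp),
        .symm (.resPar _ _ _ (by rwa [h.freeNames_eq]))⟩
  | parL h hi =>
    have := tr_label_ne h ha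
    exact ⟨_, .res (.parL h hi) this.1 this.2, .symm (.resPar _ _ _ (by rwa [h.freeNames_eq]))⟩
  | parR h hi =>
    cases h with
    | res h hn hc => exact ⟨_, .res (.parR h hi) hn hc, .symm (.resPar _ _ _ ha)⟩

theorem sub_resCons {l : Vis N} {P Q : Keyed N} {a : N} (hl : a ≠ l.base)
    (ha : a ∉ Q.freeNames) : Sub (.res (.cons l P Q) a) (.cons l (.res P a) Q) := by
  intro d i α T h
  cases h with
  | res h hn hc =>
    cases h with
    | fire h h' => exact ⟨_, .fire h h', .resFired _ _ _ _ _ hl ha⟩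
    | rest h h' => exact ⟨_, .rest h h', .resCons _ _ _ _ hl (by rwa [h'.freeNames_eq])⟩

theorem sub_resCons_symm {l : Vis N} {P Q : Keyed N} {a : N} (hl : a ≠ l.base)
    (ha : a ∉ Q.freeNames) : Sub (.cons l (.res P a) Q) (.res (.cons l P Q) a) := by
  intro d i α T h
  cases h with
  | fire h h' =>
    have := Vis.ne_of_ne_base hl
    exact ⟨_, .res (.fire h h') this.1 this.2, .symm (.resFired _ _ _ _ _ hl ha)⟩
  | rest h h' =>
    have := tr_label_ne h' ha
    exact ⟨_, .res (.rest h h') this.1 this.2,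
      .symm (.resCons _ _ _ _ hl (by rwa [h'.freeNames_eq]))⟩

theorem sub_resFired {i : ℕ} {l : Vis N} {X Q : Keyed N} {a : N} (hl : a ≠ l.base)
    (ha : a ∉ Q.freeNames) : Sub (.res (.fired i l X Q) a) (.fired i l (.res X a) Q) := by
  intro d i α T h
  cases h with
  | res h hn hc =>
    cases h with
    | unfire h h' => exact ⟨_, .unfire h h', .resCons _ _ _ _ hl ha⟩
    | under h hij h' => exact ⟨_, .under h hij (.res h' hn hc), .resFired _ _ _ _ _ hl ha⟩

theorem sub_resFired_symm {i : ℕ} {l : Vis N} {X Q : Keyed N} {a : N} (hl : a ≠ l.base)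
    (ha : a ∉ Q.freeNames) : Sub (.fired i l (.res X a) Q) (.res (.fired i l X Q) a) := by
  intro d i α T h
  cases h with
  | unfire h h' =>
    have := Vis.ne_of_ne_base hl
    exact ⟨_, .res (.unfire h h') this.1 this.2, .symm (.resCons _ _ _ _ hl ha)⟩
  | under h hij h' =>
    cases h' with
    | res h' hn hc => exact ⟨_, .res (.under h hij h') hn hc, .symm (.resFired _ _ _ _ _ hl ha)⟩

/-- Structural congruence of keyed processes is a bisimulation, for forward and for backward
transitions. -/
theorem Congr.sub {K L : Keyed N} (h : Congr K L) : Sub K L ∧ Sub L K := by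
  induction h with
  | refl K => exact ⟨fun _ _ _ _ h => ⟨_, h, .refl _⟩, fun _ _ _ _ h => ⟨_, h, .refl _⟩⟩
  | symm _ ih => exact ih.symm
  | trans _ _ ih₁ ih₂ =>
    constructor
    · intro d i α K' h
      obtain ⟨L', hL, hL'⟩ := ih₁.1 _ _ _ _ h
      obtain ⟨M', hM, hM'⟩ := ih₂.1 _ _ _ _ hL
      exact ⟨_, hM, hL'.trans hM'⟩
    · intro d i α K' h
      obtain ⟨L', hL, hL'⟩ := ih₂.2 _ _ _ _ h
      obtain ⟨M', hM, hM'⟩ := ih₁.2 _ _ _ _ hL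
      exact ⟨_, hM, hL'.trans hM'⟩
  | par h₁ h₂ ih₁ ih₂ => exact ⟨sub_par h₁ h₂ ih₁.1 ih₂.1, sub_par h₁.symm h₂.symm ih₁.2 ih₂.2⟩
  | res a _ ih => exact ⟨sub_res a ih.1, sub_res a ih.2⟩
  | cons l h₁ h₂ _ ih => exact ⟨sub_cons l h₁ h₂ ih.1, sub_cons l h₁.symm h₂.symm ih.2⟩
  | fired i l h₁ h₂ ih _ => exact ⟨sub_fired i l h₁ h₂ ih.1, sub_fired i l h₁.symm h₂.symm ih.2⟩
  | alpha K a b hb =>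
    refine ⟨sub_alpha hb, ?_⟩
    have := sub_alpha (a := b) (notMem_freeNames_rename_swap (a := a) hb)
    rwa [rename_swap_rename_swap] at this
  | sumComm => exact ⟨sub_sumComm _ _ _ _ _, sub_sumComm _ _ _ _ _⟩
  | sumFired _ _ _ _ _ _ hP => exact ⟨sub_sumFired hP, sub_sumFired_symm hP⟩
  | parComm => exact ⟨sub_parComm _ _, sub_parComm _ _⟩
  | parAssoc => exact ⟨sub_parAssoc _ _ _, sub_parAssoc_symm _ _ _⟩
  | parZero => exact ⟨sub_parZero _, sub_parZero_symm _⟩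
  | resComm => exact ⟨sub_resComm _ _ _, sub_resComm _ _ _⟩
  | resZero a =>
    constructor
    · rintro d i α T ⟨⟩; contradiction
    · rintro d i α T ⟨⟩
  | resPar _ _ _ h => exact ⟨sub_resPar h, sub_resPar_symm h⟩
  | resCons _ _ _ _ hl h => exact ⟨sub_resCons hl h, sub_resCons_symm hl h⟩
  | resFired _ _ _ _ _ hl h => exact ⟨sub_resFired hl h, sub_resFired_symm hl h⟩

theorem Congr.tr {K L K' : Keyed N} (h : Congr K L) {d : Dir} {i : ℕ} {α : Lab N}
    (hK : Tr d K i α K') : ∃ L', Tr d L i α L' ∧ Congr K' L' :=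
  h.sub.1 _ _ _ _ hK

end Keyed

/-! ### CCS processes as keyed processes -/

mutual

/-- A CCS process as a keyed process without keys. -/
def CCS.emb {N : Type u} : CCS N → Keyed N
  | .par P Q => .par P.emb Q.emb
  | .sum G => G.emb
  | .res P a => .res P.emb a

/-- A guarded sum as a keyed process without keys. -/
def Guarded.emb {N : Type u} : Guarded N → Keyed N
  | .nil => .nil
  | .cons l P Q => .cons l P.emb Q.emb

end

section

variable {N : Type u}

mutual

theorem CCS.keys_emb : (P : CCS N) → P.emb.keys = ∅
  | .par P Q => by simp [CCS.emb, Keyed.keys, CCS.keys_emb P, CCS.keys_emb Q]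
  | .sum G => by simp [CCS.emb, Guarded.keys_emb G]
  | .res P a => by simp [CCS.emb, Keyed.keys, CCS.keys_emb P]

theorem Guarded.keys_emb : (G : Guarded N) → G.emb.keys = ∅
  | .nil => by simp [Guarded.emb, Keyed.keys]
  | .cons l P Q => by simp [Guarded.emb, Keyed.keys, CCS.keys_emb P, Guarded.keys_emb Q]

end

mutual

theorem CCS.freeNames_emb : (P : CCS N) → P.emb.freeNames = P.freeNames
  | .par P Q => by
    simp [CCS.emb, Keyed.freeNames, CCS.freeNames, CCS.freeNames_emb P, CCS.freeNames_emb Q]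
  | .sum G => by simp [CCS.emb, CCS.freeNames, Guarded.freeNames_emb G]
  | .res P a => by simp [CCS.emb, Keyed.freeNames, CCS.freeNames, CCS.freeNames_emb P]

theorem Guarded.freeNames_emb : (G : Guarded N) → G.emb.freeNames = G.freeNames
  | .nil => by simp [Guarded.emb, Keyed.freeNames, Guarded.freeNames]
  | .cons l P Q => by
    simp [Guarded.emb, Keyed.freeNames, Guarded.freeNames, CCS.freeNames_emb P,
      Guarded.freeNames_emb Q]

end

mutual

theorem CCS.emb_rename (s : N → N) : (P : CCS N) → (P.rename s).emb = P.emb.rename s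
  | .par P Q => by
    simp [CCS.emb, Keyed.rename, CCS.rename, CCS.emb_rename s P, CCS.emb_rename s Q]
  | .sum G => by simp [CCS.emb, CCS.rename, Guarded.emb_rename s G]
  | .res P a => by simp [CCS.emb, Keyed.rename, CCS.rename, CCS.emb_rename s P]

theorem Guarded.emb_rename (s : N → N) : (G : Guarded N) → (G.rename s).emb = G.emb.rename s
  | .nil => by simp [Guarded.emb, Keyed.rename, Guarded.rename]
  | .cons l P Q => by
    simp [Guarded.emb, Keyed.rename, Guarded.rename, CCS.emb_rename s P, Guarded.emb_rename s Q]

end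

mutual

theorem CCS.freeNames_subset_names : (P : CCS N) → P.freeNames ⊆ P.names
  | .par P Q => Set.union_subset_union (CCS.freeNames_subset_names P)
      (CCS.freeNames_subset_names Q)
  | .sum G => Guarded.freeNames_subset_names G
  | .res P _ => Set.sdiff_subset.trans
      ((CCS.freeNames_subset_names P).trans Set.subset_union_left)

theorem Guarded.freeNames_subset_names : (G : Guarded N) → G.freeNames ⊆ G.names
  | .nil => subset_rfl
  | .cons _ P Q => Set.union_subset_union (Set.union_subset_union subset_rfl
      (CCS.freeNames_subset_names P)) (Guarded.freeNames_subset_names Q)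

end

mutual

theorem CCS.finite_names : (P : CCS N) → P.names.Finite
  | .par P Q => (CCS.finite_names P).union (CCS.finite_names Q)
  | .sum G => Guarded.finite_names G
  | .res P _ => (CCS.finite_names P).union (Set.finite_singleton _)

theorem Guarded.finite_names : (G : Guarded N) → G.names.Finite
  | .nil => Set.finite_empty
  | .cons _ P Q => ((Set.finite_singleton _).union (CCS.finite_names P)).union
      (Guarded.finite_names Q)

end

theorem Mem.finite_names : (m : Mem N) → m.names.Finite
  | .empty => Set.finite_empty
  | .fork m => Mem.finite_names m
  | .push _ _ Q m => ((Set.finite_singleton _).union Q.finite_names).union (Mem.finite_names m)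

theorem CCS.Congr.emb [DecidableEq N] {P Q : CCS N} (h : CCS.Congr P Q) :
    Keyed.Congr P.emb Q.emb := by
  induction h with
  | refl P => exact .refl _
  | symm _ ih => exact ih.symm
  | trans _ _ ih₁ ih₂ => exact ih₁.trans ih₂
  | par _ _ ih₁ ih₂ => exact .par ih₁ ih₂
  | res a _ ih => exact .res a ih
  | head l Q _ ih => exact .cons l ih (.refl _)
  | tail l P _ ih => exact .cons l (.refl _) ih
  | alpha P a b hb =>
    simp only [CCS.emb, CCS.emb_rename]
    exact .alpha _ _ _ (by rwa [CCS.freeNames_emb])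
  | sumComm => exact .sumComm _ _ _ _ _
  | parComm => exact .parComm _ _
  | parAssoc => exact .parAssoc _ _ _
  | parZero => exact .parZero _
  | resComm => exact .resComm _ _ _
  | resZero => exact .resZero _
  | resPar P Q a ha => exact .resPar _ _ _ (by rwa [CCS.freeNames_emb])

end

/-! ### Reversible processes and keyed processes -/

namespace RCCS

variable {N : Type u}

/-- `Rep R m K`: the reversible process `R` is the keyed process `K` run on top of the memory `m`,
which all threads of `R` share. The executed prefixes of `K` are read off from the memories of `R`
above `m`. -/
inductive Rep : RCCS N → Mem N → Keyed N → Prop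
  | thread (m : Mem N) (P : CCS N) : Rep (.thread m P) m P.emb
  | push {R : RCCS N} {i : ℕ} {l : Vis N} {Q : Guarded N} {m : Mem N} {K : Keyed N} :
      Rep R (.push i l (.sum Q) m) K → Rep R m (.fired i l K Q.emb)
  | par {R S : RCCS N} {m : Mem N} {K L : Keyed N} : Rep R (.fork m) K → Rep S (.fork m) L →
      Rep (.par R S) m (.par K L)
  | res {R : RCCS N} {m : Mem N} {K : Keyed N} {a : N} : a ∉ m.names → Rep R m K →
      Rep (.res R a) m (.res K a)

/-- `Rep R m K` by the rule for the outermost constructor of `R`, without unwinding a memory. -/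
def Core : RCCS N → Mem N → Keyed N → Prop
  | thread m₀ P, m, K => m₀ = m ∧ K = P.emb
  | par R S, m, K => ∃ K₁ K₂, K = .par K₁ K₂ ∧ Rep R (.fork m) K₁ ∧ Rep S (.fork m) K₂
  | res R a, m, K => ∃ K₁, K = .res K₁ a ∧ a ∉ m.names ∧ Rep R m K₁

theorem Rep.core_induction {R : RCCS N} {C : Mem N → Keyed N → Prop}
    (core : ∀ m K, Core R m K → C m K)
    (push : ∀ i l Q m K, Rep R (.push i l (.sum Q) m) K → C (.push i l (.sum Q) m) K →
      C m (.fired i l K Q.emb))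
    {m : Mem N} {K : Keyed N} (h : Rep R m K) : C m K := by
  induction h with
  | thread m P => exact core _ _ ⟨rfl, rfl⟩
  | push h ih => exact push _ _ _ _ _ h (ih core push)
  | par h₁ h₂ => exact core _ _ ⟨_, _, rfl, h₁, h₂⟩
  | res ha h => exact core _ _ ⟨_, rfl, ha, h⟩

theorem Rep.ids_eq {R : RCCS N} {m : Mem N} {K : Keyed N} (h : Rep R m K) :
    R.ids = m.ids ∪ K.keys := by
  induction h with
  | thread m P => simp [ids, CCS.keys_emb]
  | push h ih => simp [ih, Mem.ids, Keyed.keys, Guarded.keys_emb, Set.insert_union]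
  | par _ _ ih₁ ih₂ =>
    ext; simp [ih₁, ih₂, ids, Mem.ids, Keyed.keys]; tauto
  | res _ _ ih => simpa [ids, Keyed.keys] using ih

theorem Rep.thread_inv {m₀ m : Mem N} {P : CCS N} {K : Keyed N} (h : Rep (.thread m₀ P) m K) :
    (m₀ = m ∧ K = P.emb) ∨ ∃ i l Q m', m₀ = .push i l Q m' := by
  refine Rep.core_induction (R := .thread m₀ P) (C := fun m K => (m₀ = m ∧ K = P.emb) ∨
    ∃ i l Q m', m₀ = .push i l Q m') (fun m K h => .inl h) ?_ h
  rintro i l Q m K - (⟨rfl, -⟩ | h)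
  · exact .inr ⟨_, _, _, _, rfl⟩
  · exact .inr h

theorem Rep.names_subset {m₀ m : Mem N} {P : CCS N} {K : Keyed N} (h : Rep (.thread m₀ P) m K) :
    m.names ⊆ m₀.names := by
  refine Rep.core_induction (C := fun m _ => m.names ⊆ m₀.names) (fun m K h => ?_) ?_ h
  · exact h.1 ▸ subset_rfl
  · rintro i l Q m K - h
    exact Set.subset_union_right.trans h

theorem Rep.ids_subset {R : RCCS N} {m : Mem N} {K : Keyed N} (h : Rep R m K) :
    m.ids ⊆ R.ids := by
  simp [h.ids_eq]

variable [DecidableEq N]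

/-- `Rep` up to congruence of keyed processes. -/
def RepC (R : RCCS N) (m : Mem N) (K : Keyed N) : Prop :=
  ∃ K₀, Rep R m K₀ ∧ Keyed.Congr K₀ K

theorem Rep.repC {R : RCCS N} {m : Mem N} {K : Keyed N} (h : Rep R m K) : RepC R m K :=
  ⟨K, h, .refl K⟩

namespace RepC

variable {R S : RCCS N} {m : Mem N} {K L : Keyed N}

theorem congr (h : RepC R m K) (hKL : Keyed.Congr K L) : RepC R m L :=
  let ⟨K₀, h₀, hK⟩ := h
  ⟨K₀, h₀, hK.trans hKL⟩

theorem push {i : ℕ} {l : Vis N} {Q : Guarded N} (h : RepC R (.push i l (.sum Q) m) K) :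
    RepC R m (.fired i l K Q.emb) :=
  let ⟨_, h₀, hK⟩ := h
  ⟨_, .push h₀, .fired _ _ hK (.refl _)⟩

theorem par (hR : RepC R (.fork m) K) (hS : RepC S (.fork m) L) :
    RepC (.par R S) m (.par K L) :=
  let ⟨_, h₀, hK⟩ := hR
  let ⟨_, h₁, hL⟩ := hS
  ⟨_, .par h₀ h₁, .par hK hL⟩

theorem res {a : N} (ha : a ∉ m.names) (h : RepC R m K) : RepC (.res R a) m (.res K a) :=
  let ⟨_, h₀, hK⟩ := h
  ⟨_, .res ha h₀, .res a hK⟩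

theorem ids_eq (h : RepC R m K) : R.ids = m.ids ∪ K.keys :=
  let ⟨_, h₀, hK⟩ := h
  h₀.ids_eq.trans (by rw [hK.keys_eq])

end RepC

/-- Restriction commutes with the memory of a thread. This is where the congruences `resFired`
and `resCons` of keyed processes are needed. -/
theorem Rep.scope {m₀ m : Mem N} {P : CCS N} {K : Keyed N} {a : N} (ha : a ∉ m₀.names)
    (h : Rep (.thread m₀ P) m K) : RepC (.thread m₀ (.res P a)) m (.res K a) := by
  refine Rep.core_induction (C := fun m K => RepC (.thread m₀ (.res P a)) m (.res K a)) ?_ ?_ h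
  · rintro m K ⟨rfl, rfl⟩
    exact (Rep.thread m₀ (.res P a)).repC
  · rintro i l Q m K h' h
    have hm : a ∉ (Mem.push i l (.sum Q) m).names := fun h => ha (h'.names_subset h)
    simp only [Mem.names, Set.mem_union, Set.mem_singleton_iff, not_or] at hm
    refine h.push.congr (.symm (.resFired _ _ _ _ _ hm.1.1 ?_))
    rw [Guarded.freeNames_emb]
    exact fun h => hm.1.2 (Guarded.freeNames_subset_names _ h)

/-- Structurally equivalent reversible processes represent the same keyed processes, up to
congruence. -/
theorem Congr.rep {R S : RCCS N} (h : Congr R S) :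
    (∀ m K, Rep R m K → RepC S m K) ∧ (∀ m K, Rep S m K → RepC R m K) := by
  induction h with
  | refl R => exact ⟨fun _ _ h => h.repC, fun _ _ h => h.repC⟩
  | symm _ ih => exact ih.symm
  | trans _ _ ih₁ ih₂ =>
    constructor
    · intro m K h
      obtain ⟨K₁, h₁, hK⟩ := ih₁.1 _ _ h
      exact (ih₂.1 _ _ h₁).congr hK
    · intro m K h
      obtain ⟨K₁, h₁, hK⟩ := ih₂.2 _ _ h
      exact (ih₁.2 _ _ h₁).congr hK
  | par _ _ ih₁ ih₂ =>
    constructor <;> intro m K h <;>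
      refine Rep.core_induction ?_ (fun _ _ _ _ _ _ h => h.push) h
    · rintro m K ⟨K₁, K₂, rfl, h₁, h₂⟩
      exact (ih₁.1 _ _ h₁).par (ih₂.1 _ _ h₂)
    · rintro m K ⟨K₁, K₂, rfl, h₁, h₂⟩
      exact (ih₁.2 _ _ h₁).par (ih₂.2 _ _ h₂)
  | res a _ ih =>
    constructor <;> intro m K h <;>
      refine Rep.core_induction ?_ (fun _ _ _ _ _ _ h => h.push) h
    · rintro m K ⟨K₁, rfl, ha, h₁⟩
      exact (ih.1 _ _ h₁).res ha
    · rintro m K ⟨K₁, rfl, ha, h₁⟩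
      exact (ih.2 _ _ h₁).res ha
  | thread m₀ h =>
    constructor <;> intro m K h' <;>
      refine Rep.core_induction ?_ (fun _ _ _ _ _ _ h => h.push) h'
    · rintro m K ⟨rfl, rfl⟩
      exact (Rep.thread _ _).repC.congr h.emb.symm
    · rintro m K ⟨rfl, rfl⟩
      exact (Rep.thread _ _).repC.congr h.emb
  | distrib m₀ P Q =>
    constructor <;> intro m K h' <;>
      refine Rep.core_induction ?_ (fun _ _ _ _ _ _ h => h.push) h'
    · rintro m K ⟨rfl, rfl⟩
      exact (Rep.par (.thread _ P) (.thread _ Q)).repC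
    · rintro m K ⟨K₁, K₂, rfl, h₁, h₂⟩
      rcases h₁.thread_inv with ⟨⟨⟩, rfl⟩ | ⟨_, _, _, _, ⟨⟩⟩
      rcases h₂.thread_inv with ⟨-, rfl⟩ | ⟨_, _, _, _, ⟨⟩⟩
      exact (Rep.thread m₀ (.par P Q)).repC
  | scope m₀ P a ha =>
    constructor <;> intro m K h' <;>
      refine Rep.core_induction ?_ (fun _ _ _ _ _ _ h => h.push) h'
    · rintro m K ⟨rfl, rfl⟩
      exact (Rep.res ha (.thread m₀ P)).repC
    · rintro m K ⟨K₁, rfl, -, h₁⟩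
      exact h₁.scope ha

theorem Congr.repC {R S : RCCS N} {m : Mem N} {K : Keyed N} (h : Congr R S) (hR : RepC R m K) :
    RepC S m K :=
  let ⟨_, h₀, hK⟩ := hR
  (h.rep.1 _ _ h₀).congr hK

theorem Congr.ids_eq {R S : RCCS N} (h : Congr R S) : R.ids = S.ids := by
  induction h with
  | symm _ ih => exact ih.symm
  | trans _ _ ih₁ ih₂ => exact ih₁.trans ih₂
  | _ => simp_all [ids, Mem.ids]

theorem Step.notMem_ids {R R' : RCCS N} {i : ℕ} {α : Lab N} (h : Step .fwd R i α R') :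
    i ∉ R.ids := by
  generalize hd : Dir.fwd = d at h
  induction h with
  | actRev => cases hd
  | congr h _ _ ih => rw [h.ids_eq]; exact ih hd
  | _ => simp_all [ids]

/-- A backward transition with identifier `i`, label `α` and target `R'` that undoes the topmost
entry of the shared memory `m`, on top of which `K` has no executed prefix. -/
def Undoes (R' : RCCS N) (i : ℕ) (α : Lab N) (m : Mem N) (K : Keyed N) : Prop :=
  ∃ l Q m', m = .push i l (.sum Q) m' ∧ i ∉ m'.ids ∧ α = .vis l ∧ K.keys = ∅ ∧
    RepC R' m' (.cons l K Q.emb)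

theorem Undoes.of_core {R R' : RCCS N} {i : ℕ} {α : Lab N}
    (core : ∀ m K, Core R m K → i ∈ m.ids → Undoes R' i α m K) {m : Mem N} {K : Keyed N}
    (hR : Rep R m K) (hi : i ∈ m.ids) : Undoes R' i α m K := by
  revert hi
  refine Rep.core_induction (C := fun m K => i ∈ m.ids → Undoes R' i α m K) core ?_ hR
  -- The entry undone is the topmost one of a longer memory, hence its identifier is not in `m`.
  intro j l Q m K _ ih hi
  obtain ⟨_, _, _, ⟨⟩, hi', _⟩ := ih (.inr hi)
  exact absurd hi hi'

/-- A backward transition whose identifier lies in the shared memory `m` undoes the topmost entry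
of `m`, and is possible only if nothing was executed on top of `m`. -/
theorem Step.undo {R R' : RCCS N} {i : ℕ} {α : Lab N} (h : Step .bwd R i α R') {m : Mem N}
    {K : Keyed N} (hR : Rep R m K) (hi : i ∈ m.ids) : Undoes R' i α m K := by
  generalize hd : Dir.bwd = d at h
  induction h generalizing m K with
  | act => cases hd
  | actRev m₀ i l P Q hi₀ =>
    refine .of_core ?_ hR hi
    rintro m K ⟨rfl, rfl⟩ -
    exact ⟨l, Q, m₀, rfl, hi₀, rfl, CCS.keys_emb _, (Rep.thread _ (.sum (.cons _ _ _))).repC⟩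
  | syn _ _ ih =>
    refine .of_core ?_ hR hi
    rintro m K ⟨K₁, K₂, rfl, h₁, -⟩ hi
    obtain ⟨_, _, _, ⟨⟩, _⟩ := ih h₁ hi hd
  | parL S _ hS =>
    refine .of_core ?_ hR hi
    rintro m K ⟨K₁, K₂, rfl, -, h₂⟩ hi
    exact absurd (h₂.ids_subset hi) hS
  | parR S _ hS =>
    refine .of_core ?_ hR hi
    rintro m K ⟨K₁, K₂, rfl, h₁, -⟩ hi
    exact absurd (h₁.ids_subset hi) hS
  | res a _ _ _ ih =>
    refine .of_core ?_ hR hi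
    rintro m K ⟨K₁, rfl, ha, h₁⟩ hi
    obtain ⟨l, Q, m', rfl, hi', hα, hK, hR'⟩ := ih h₁ hi hd
    simp only [Mem.names, Set.mem_union, Set.mem_singleton_iff, not_or] at ha
    refine ⟨l, Q, m', rfl, hi', hα, hK, (hR'.res ha.2).congr (.resCons _ _ _ _ ha.1.1 ?_)⟩
    rw [Guarded.freeNames_emb]
    exact fun h => ha.1.2 (Guarded.freeNames_subset_names _ h)
  | congr h _ h' ih =>
    obtain ⟨K₁, h₁, hK₁⟩ := h.rep.1 _ _ hR
    obtain ⟨l, Q, m', hm, hi', hα, hK, hR'⟩ := ih h₁ hi hd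
    exact ⟨l, Q, m', hm, hi', hα, hK₁.keys_eq ▸ hK, (h'.repC hR').congr (.cons _ hK₁ (.refl _))⟩

/-- Executed prefixes in the memory do not interfere with a transition of what runs on top of them;
the one exception is a backward transition that undoes the topmost of them. -/
theorem Step.tr_of_core {d : Dir} {R R' : RCCS N} {i : ℕ} {α : Lab N} (hs : Step d R i α R')
    (core : ∀ m K, Core R m K → i ∉ m.ids → ∃ K', Keyed.Tr d K i α K' ∧ RepC R' m K')
    {m : Mem N} {K : Keyed N} (hR : Rep R m K) (hi : i ∉ m.ids) :
    ∃ K', Keyed.Tr d K i α K' ∧ RepC R' m K' := by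
  revert hi
  refine Rep.core_induction (C := fun m K => i ∉ m.ids →
    ∃ K', Keyed.Tr d K i α K' ∧ RepC R' m K') core ?_ hR
  intro j l Q m K h ih hi
  by_cases hij : i = j
  · subst hij
    cases d with
    | fwd => exact absurd (h.ids_subset (.inl rfl)) hs.notMem_ids
    | bwd =>
      obtain ⟨_, _, _, ⟨⟩, _, rfl, hK, h'⟩ := hs.undo h (.inl rfl)
      exact ⟨_, .unfire hK (Guarded.keys_emb Q), h'⟩
  · obtain ⟨K', hK', h'⟩ := ih (by simp [Mem.ids, hij, hi])
    exact ⟨_, .under (Guarded.keys_emb Q) hij hK', h'.push⟩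

/-- Transitions of reversible processes are transitions of the keyed processes they represent. -/
theorem Step.tr {d : Dir} {R R' : RCCS N} {i : ℕ} {α : Lab N} (hs : Step d R i α R')
    {m : Mem N} {K : Keyed N} (hR : Rep R m K) (hi : i ∉ m.ids) :
    ∃ K', Keyed.Tr d K i α K' ∧ RepC R' m K' := by
  induction hs generalizing m K with
  | act m₀ i l P Q hi₀ =>
    refine Step.tr_of_core (.act m₀ i l P Q hi₀) ?_ hR hi
    rintro m K ⟨rfl, rfl⟩ hi
    exact ⟨_, .fire (CCS.keys_emb P) (Guarded.keys_emb Q), (Rep.push (.thread _ P)).repC⟩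
  | actRev m₀ i l P Q hi₀ =>
    refine Step.tr_of_core (.actRev m₀ i l P Q hi₀) ?_ hR hi
    rintro m K ⟨rfl, rfl⟩ hi
    exact absurd (.inl rfl) hi
  | syn h₁ h₂ ih₁ ih₂ =>
    refine Step.tr_of_core (.syn h₁ h₂) ?_ hR hi
    rintro m K ⟨K₁, K₂, rfl, hK₁, hK₂⟩ hi
    obtain ⟨L₁, hL₁, hR₁⟩ := ih₁ hK₁ hi
    obtain ⟨L₂, hL₂, hR₂⟩ := ih₂ hK₂ hi
    exact ⟨_, .syn hL₁ hL₂, hR₁.par hR₂⟩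
  | parL S h hS ih =>
    refine Step.tr_of_core (.parL S h hS) ?_ hR hi
    rintro m K ⟨K₁, K₂, rfl, hK₁, hK₂⟩ hi
    obtain ⟨L₁, hL₁, hR₁⟩ := ih hK₁ hi
    exact ⟨_, .parL hL₁ fun h => hS (hK₂.ids_eq ▸ .inr h), hR₁.par hK₂.repC⟩
  | parR S h hS ih =>
    refine Step.tr_of_core (.parR S h hS) ?_ hR hi
    rintro m K ⟨K₁, K₂, rfl, hK₁, hK₂⟩ hi
    obtain ⟨L₂, hL₂, hR₂⟩ := ih hK₂ hi
    exact ⟨_, .parR hL₂ fun h => hS (hK₁.ids_eq ▸ .inr h), hK₁.repC.par hR₂⟩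
  | res a h hn hc ih =>
    refine Step.tr_of_core (.res a h hn hc) ?_ hR hi
    rintro m K ⟨K₁, rfl, ha, hK₁⟩ hi
    obtain ⟨L₁, hL₁, hR₁⟩ := ih hK₁ hi
    exact ⟨_, .res hL₁ hn hc, hR₁.res ha⟩
  | congr h _ h' ih =>
    obtain ⟨K₁, hK₁, hK⟩ := h.rep.1 _ _ hR
    obtain ⟨L₁, hL₁, hR₁⟩ := ih hK₁ hi
    obtain ⟨L, hL, hLL⟩ := hK.tr hL₁
    exact ⟨L, hL, (h'.repC hR₁).congr hLL⟩

/-- Without executed prefixes, all memories can be merged into the shared one. -/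
theorem Rep.exists_thread {R : RCCS N} {m : Mem N} {K : Keyed N} (h : Rep R m K)
    (hK : K.keys = ∅) : ∃ P, K = P.emb ∧ Congr R (.thread m P) := by
  induction h with
  | thread m P => exact ⟨P, rfl, .refl _⟩
  | push => exact absurd hK (Set.insert_nonempty _ _).ne_empty
  | par _ _ ih₁ ih₂ =>
    simp only [Keyed.keys, Set.union_empty_iff] at hK
    obtain ⟨P, rfl, hP⟩ := ih₁ hK.1
    obtain ⟨Q, rfl, hQ⟩ := ih₂ hK.2
    exact ⟨.par P Q, rfl, .trans (.par hP hQ) (.symm (.distrib _ _ _))⟩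
  | res ha _ ih =>
    obtain ⟨P, rfl, hP⟩ := ih hK
    exact ⟨.res P _, rfl, .trans (.res _ hP) (.symm (.scope _ _ _ ha))⟩

/-- The executed summand of a guarded sum can be moved to its head. -/
theorem _root_.Guarded.exists_head {d : Dir} {i : ℕ} {α : Lab N} : (G : Guarded N) →
    {K : Keyed N} → Keyed.Tr d G.emb i α K →
    ∃ l P G', d = .fwd ∧ α = .vis l ∧ CCS.Congr (.sum G) (.sum (.cons l P G')) ∧
      Keyed.Congr (.fired i l P.emb G'.emb) K
  | .nil, _, h => nomatch h
  | .cons l P Q, _, .fire _ _ => ⟨l, P, Q, rfl, rfl, .refl _, .refl _⟩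
  | .cons l P Q, _, .rest _ h => by
    obtain ⟨l', P', G', hd, hα, hG, hK⟩ := Guarded.exists_head Q h
    refine ⟨l', P', .cons l P G', hd, hα, .trans (.tail l P hG) (.sumComm _ _ _ _ _), ?_⟩
    exact .trans (.symm (.sumFired _ _ _ _ _ _ (CCS.keys_emb P))) (.cons _ (.refl _) hK)

/-- The transitions of `K` on top of the memory `m` are transitions of `R`. -/
def Realizes (R : RCCS N) (m : Mem N) (K : Keyed N) : Prop :=
  ∀ d i α K', Keyed.Tr d K i α K' → i ∉ m.ids → ∃ R', Step d R i α R' ∧ RepC R' m K'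

namespace Realizes

variable {R S : RCCS N} {m : Mem N} {K L : Keyed N}

theorem congr_left (h : Congr R S) (hS : Realizes S m K) : Realizes R m K := by
  intro d i α K' hK hi
  obtain ⟨R', hR', hr⟩ := hS d i α K' hK hi
  exact ⟨R', .congr h hR' (.refl _), hr⟩

theorem congr_right (h : Keyed.Congr K L) (hL : Realizes R m L) : Realizes R m K := by
  intro d i α K' hK hi
  obtain ⟨L', hL', hKL⟩ := h.tr hK
  obtain ⟨R', hR', hr⟩ := hL d i α L' hL' hi
  exact ⟨R', hR', hr.congr hKL.symm⟩

theorem par (hR : Rep R (.fork m) K) (hS : Rep S (.fork m) L) (hK : Realizes R (.fork m) K)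
    (hL : Realizes S (.fork m) L) : Realizes (.par R S) m (.par K L) := by
  intro d i α T h hi
  cases h with
  | syn h h' =>
    obtain ⟨R', hR', hr⟩ := hK _ _ _ _ h hi
    obtain ⟨S', hS', hs⟩ := hL _ _ _ _ h' hi
    exact ⟨_, .syn hR' hS', hr.par hs⟩
  | parL h hj =>
    obtain ⟨R', hR', hr⟩ := hK _ _ _ _ h hi
    refine ⟨_, .parL _ hR' ?_, hr.par hS.repC⟩
    rw [hS.ids_eq]
    exact fun h => h.elim hi hj
  | parR h hj =>
    obtain ⟨S', hS', hs⟩ := hL _ _ _ _ h hi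
    refine ⟨_, .parR _ hS' ?_, hR.repC.par hs⟩
    rw [hR.ids_eq]
    exact fun h => h.elim hi hj

theorem res {a : N} (ha : a ∉ m.names) (hK : Realizes R m K) :
    Realizes (.res R a) m (.res K a) := by
  intro d i α T h hi
  cases h with
  | res h hn hc =>
    obtain ⟨R', hR', hr⟩ := hK _ _ _ _ h hi
    exact ⟨_, .res _ hR' hn hc, hr.res ha⟩

end Realizes

/-- Transitions of keyed processes are transitions of the reversible processes that represent them.
A restriction in a thread is first renamed to a name that does not occur in the memory. -/
theorem Rep.realizes [Infinite N] {R : RCCS N} {m : Mem N} {K : Keyed N} (h : Rep R m K) :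
    Realizes R m K := by
  induction hn : K.size using Nat.strong_induction_on generalizing R m K with
  | _ n ih =>
    subst hn
    cases h with
    | thread _ P =>
      cases P with
      | par P Q =>
        have h₁ := Rep.thread (.fork m) P
        have h₂ := Rep.thread (.fork m) Q
        refine .congr_left (.distrib m P Q) (.par h₁ h₂ (ih _ ?_ h₁ rfl) (ih _ ?_ h₂ rfl)) <;>
          simp only [CCS.emb, Keyed.size] <;> lia
      | sum G =>
        intro d i α T h hi
        obtain ⟨l, P, G', rfl, rfl, hG, hT⟩ := G.exists_head h
        exact ⟨_, .congr (.thread m hG) (.act m i l P G' hi) (.refl _),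
          (Rep.push (.thread _ P)).repC.congr hT⟩
      | res P a =>
        obtain ⟨b, hb⟩ := (m.finite_names.union P.finite_names).exists_notMem
        simp only [Set.mem_union, not_or] at hb
        have hbP : b ∉ P.freeNames := fun h => hb.2 (CCS.freeNames_subset_names _ h)
        have h₁ := Rep.thread m (P.rename (Equiv.swap a b))
        refine .congr_left (.trans (.thread m (.alpha P a b hbP)) (.scope _ _ _ hb.1))
          (.congr_right (CCS.Congr.alpha P a b hbP).emb (.res hb.1 (ih _ ?_ h₁ rfl)))
        simp [CCS.emb, CCS.emb_rename, Keyed.size]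
    | @push _ j l Q _ K h =>
      have hK := ih _ (by simp only [Keyed.size]; lia) h rfl
      intro d i α T hT hi
      cases hT with
      | unfire hP _ =>
        obtain ⟨P, rfl, hR⟩ := h.exists_thread hP
        exact ⟨_, .congr hR (.actRev _ _ _ _ _ hi) (.refl _),
          (Rep.thread _ (.sum (.cons l P Q))).repC⟩
      | under _ hij hT =>
        obtain ⟨R', hR', hr⟩ := hK _ _ _ _ hT (by simp [Mem.ids, hij, hi])
        exact ⟨_, hR', hr.push⟩
    | par h₁ h₂ =>
      refine .par h₁ h₂ (ih _ ?_ h₁ rfl) (ih _ ?_ h₂ rfl) <;> simp only [Keyed.size] <;> lia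
    | res ha h => exact .res ha (ih _ (by simp [Keyed.size]) h rfl)

/-- The reversible process `R`, on the empty memory, is the keyed process `K` up to congruence. -/
def Sim (R : RCCS N) (K : Keyed N) : Prop :=
  RepC R .empty K

theorem sim_start (P : CCS N) : Sim (start P) P.emb :=
  (Rep.thread _ P).repC

theorem Sim.ids_eq {R : RCCS N} {K : Keyed N} (h : Sim R K) : R.ids = K.keys := by
  simpa [Mem.ids] using RepC.ids_eq h

theorem Sim.tr {d : Dir} {R R' : RCCS N} {i : ℕ} {α : Lab N} {K : Keyed N} (h : Sim R K)
    (hs : Step d R i α R') : ∃ K', Keyed.Tr d K i α K' ∧ Sim R' K' := by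
  obtain ⟨K₀, h₀, hK⟩ := h
  obtain ⟨K₁, h₁, hR'⟩ := hs.tr h₀ (Set.notMem_empty i)
  obtain ⟨K₂, h₂, hK'⟩ := hK.tr h₁
  exact ⟨K₂, h₂, hR'.congr hK'⟩

theorem Sim.step [Infinite N] {d : Dir} {R : RCCS N} {i : ℕ} {α : Lab N} {K K' : Keyed N}
    (h : Sim R K) (hK : Keyed.Tr d K i α K') : ∃ R', Step d R i α R' ∧ Sim R' K' := by
  obtain ⟨K₀, h₀, hK₀⟩ := h
  exact h₀.realizes.congr_right hK₀.symm d i α K' hK (Set.notMem_empty i)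

end RCCS

/-! ### Runs of keyed processes -/

namespace Keyed

variable {N : Type u}

/-- `Run s σ K`: there is a sequence of forward transitions from `s` to `K`; `σ` lists their keys
and labels, the most recent one first. -/
inductive Run (s : Keyed N) : List (ℕ × Lab N) → Keyed N → Prop
  | nil : Run s [] s
  | snoc {σ : List (ℕ × Lab N)} {K K' : Keyed N} {i : ℕ} {α : Lab N} :
      Run s σ K → Tr .fwd K i α K' → Run s ((i, α) :: σ) K'

theorem Run.mem_keys {s K : Keyed N} {σ : List (ℕ × Lab N)} (hs : s.keys = ∅) (h : Run s σ K)
    {i : ℕ} : i ∈ K.keys ↔ ∃ α, (i, α) ∈ σ := by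
  induction h with
  | nil => simp [hs]
  | @snoc σ K K' j β h h' ih =>
    simp [h'.keys_fwd, ih, exists_or]

theorem Run.nodup {s K : Keyed N} {σ : List (ℕ × Lab N)} (hs : s.keys = ∅) (h : Run s σ K) :
    (σ.map Prod.fst).Nodup := by
  induction h with
  | nil => simp
  | snoc h h' ih =>
    have := h'.keys_fwd.1
    rw [h.mem_keys hs] at this
    simpa using ⟨by simpa using this, ih⟩

/-- If `K` can undo `(i, α)` then a run to `K` stays a run when `(i, α)` is left out, and each later
entry of the run could be undone as well as `(i, α)` in some process on the way. -/
theorem Run.bwd {s K K₀ : Keyed N} {σ : List (ℕ × Lab N)} {i : ℕ} {α : Lab N} (hs : s.keys = ∅)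
    (h : Run s σ K) (h₀ : Tr .bwd K i α K₀) :
    ∃ σ₁ σ₂, σ = σ₁ ++ (i, α) :: σ₂ ∧ Run s (σ₁ ++ σ₂) K₀ ∧
      ∀ k β, (k, β) ∈ σ₁ → k ≠ i ∧ ∃ τ L L₀ L₁, Run s τ L ∧ Tr .bwd L i α L₀ ∧
        Tr .bwd L k β L₁ := by
  induction h generalizing K₀ with
  | nil => simpa [hs] using h₀.mem_keys_of_bwd
  | @snoc σ K K' k β h h' ih =>
    rcases h₀.bwd_diamond h'.flip with ⟨rfl, rfl, rfl⟩ | ⟨hne, K₂, h₂, h₃⟩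
    · exact ⟨[], σ, rfl, h, by simp⟩
    · obtain ⟨σ₁, σ₂, rfl, hσ, H⟩ := ih h₃
      refine ⟨(k, β) :: σ₁, σ₂, rfl, .snoc hσ h₂.flip, ?_⟩
      rintro k' β' hk
      rcases List.mem_cons.1 hk with hk | hk
      · cases hk
        exact ⟨hne.symm, _, _, _, _, .snoc h h', h₀, h'.flip⟩
      · exact H _ _ hk

theorem Run.nil_inv {σ : List (ℕ × Lab N)} {K : Keyed N} (h : Run .nil σ K) : K = .nil := by
  induction h with
  | nil => rfl
  | snoc _ h ih => subst ih; cases h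

theorem Run.res_inv {s T : Keyed N} {a : N} {σ : List (ℕ × Lab N)} (h : Run (.res s a) σ T) :
    ∃ K, T = .res K a ∧ Run s σ K ∧
      ∀ i α, (i, α) ∈ σ → α ≠ .vis (.name a) ∧ α ≠ .vis (.coname a) := by
  induction h with
  | nil => exact ⟨s, rfl, .nil, by simp⟩
  | snoc _ h ih =>
    obtain ⟨K, rfl, hK, H⟩ := ih
    cases h with
    | res h hn hc =>
      refine ⟨_, rfl, .snoc hK h, fun i α hi => ?_⟩
      rcases List.mem_cons.1 hi with hi | hi
      · cases hi; exact ⟨hn, hc⟩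
      · exact H _ _ hi

theorem Run.cons_inv {s t T : Keyed N} {l : Vis N} {σ : List (ℕ × Lab N)}
    (h : Run (.cons l s t) σ T) :
    (∃ t', T = .cons l s t' ∧ Run t σ t') ∨ ∃ i X τ, T = .fired i l X t ∧ Run s τ X := by
  induction h with
  | nil => exact .inl ⟨t, rfl, .nil⟩
  | @snoc σ K K' i α _ h ih =>
    rcases ih with ⟨t', rfl, h'⟩ | ⟨j, X, τ, rfl, h'⟩
    · cases h with
      | fire hs ht' =>
        -- The rest of the sum can only be the initial one, since it has no keys.
        cases h' with
        | nil => exact .inr ⟨_, _, _, rfl, .nil⟩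
        | snoc _ h' => exact absurd (h'.keys_fwd.2.symm.trans ht') (Set.insert_nonempty _ _).ne_empty
      | rest _ h => exact .inl ⟨_, rfl, .snoc h' h⟩
    · cases h with
      | under _ _ h => exact .inr ⟨_, _, _, rfl, .snoc h' h⟩

/-- A run of a parallel composition is composed of runs of the components, which share exactly the
keys of the synchronizations. -/
theorem Run.par_inv {s t T : Keyed N} {σ : List (ℕ × Lab N)} (hs : s.keys = ∅) (ht : t.keys = ∅)
    (h : Run (.par s t) σ T) :
    ∃ K L σ₁ σ₂, T = .par K L ∧ Run s σ₁ K ∧ Run t σ₂ L ∧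
      ∀ i α β, (i, α) ∈ σ₁ → (i, β) ∈ σ₂ → ∃ l, α = .vis l ∧ β = .vis l.co := by
  induction h with
  | nil => exact ⟨s, t, [], [], rfl, .nil, .nil, by simp⟩
  | snoc _ h ih =>
    obtain ⟨K, L, σ₁, σ₂, rfl, hK, hL, H⟩ := ih
    cases h with
    | syn h h' =>
      have hi := h.keys_fwd.1
      have hi' := h'.keys_fwd.1
      rw [hK.mem_keys hs, not_exists] at hi
      rw [hL.mem_keys ht, not_exists] at hi'
      refine ⟨_, _, _, _, rfl, .snoc hK h, .snoc hL h', fun j α β hα hβ => ?_⟩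
      rcases List.mem_cons.1 hα with hα | hα <;> rcases List.mem_cons.1 hβ with hβ | hβ
      · cases hα; cases hβ; exact ⟨_, rfl, rfl⟩
      · cases hα; exact absurd hβ (hi' _)
      · cases hβ; exact absurd hα (hi _)
      · exact H _ _ _ hα hβ
    | parL h hi =>
      rw [hL.mem_keys ht, not_exists] at hi
      refine ⟨_, _, _, _, rfl, .snoc hK h, hL, fun j α β hα hβ => ?_⟩
      rcases List.mem_cons.1 hα with hα | hα
      · cases hα; exact absurd hβ (hi _)
      · exact H _ _ _ hα hβ
    | parR h hi =>
      rw [hK.mem_keys hs, not_exists] at hi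
      refine ⟨_, _, _, _, rfl, hK, .snoc hL h, fun j α β hα hβ => ?_⟩
      rcases List.mem_cons.1 hβ with hβ | hβ
      · cases hβ; exact absurd hα (hi _)
      · exact H _ _ _ hα hβ

end Keyed

/-! ### Runs and configurations -/

namespace ConfStr

variable {N : Type u}

open Keyed

/-- The events that have occurred in the keyed process `K`. -/
def events {E : Type v} (occ : Keyed N → E → ℕ → Prop) (K : Keyed N) : Set E :=
  {e | ∃ i, occ K e i}

/-- The relation `occ K e i`, read as "the event `e` has occurred in `K` with key `i`", makes the
configuration structure with configurations `C` and labelling `lab` a model of the keyed process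
`s`: each transition adds one event, with the label of the transition, and the events that have
occurred in a run form a configuration. -/
structure Model {E : Type v} (C : Set (Set E)) (lab : E → Lab N) (s : Keyed N)
    (occ : Keyed N → E → ℕ → Prop) : Prop where
  keys_eq : s.keys = ∅
  start : ∀ e i, ¬ occ s e i
  step : ∀ {σ K i α K'}, Run s σ K → Tr .fwd K i α K' → ∃ e, lab e = α ∧
    (∀ j, ¬ occ K e j) ∧ ∀ e' j, occ K' e' j ↔ occ K e' j ∨ (e' = e ∧ j = i)
  conf : ∀ {σ K}, Run s σ K → events occ K ∈ C

namespace Model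

variable {E E' : Type v} {C : Set (Set E)} {C' : Set (Set E')} {lab : E → Lab N}
  {lab' : E' → Lab N} {s t K : Keyed N} {occ : Keyed N → E → ℕ → Prop}
  {occ' : Keyed N → E' → ℕ → Prop} {σ : List (ℕ × Lab N)}

theorem mem_run (M : Model C lab s occ) (h : Run s σ K) {e : E} {i : ℕ} (he : occ K e i) :
    (i, lab e) ∈ σ := by
  induction h with
  | nil => exact absurd he (M.start e i)
  | snoc h h' ih =>
    obtain ⟨e₀, rfl, -, H⟩ := M.step h h'
    rcases (H _ _).1 he with h | ⟨rfl, rfl⟩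
    · exact .tail _ (ih h)
    · exact .head _

theorem mem_keys (M : Model C lab s occ) (h : Run s σ K) {e : E} {i : ℕ} (he : occ K e i) :
    i ∈ K.keys :=
  (h.mem_keys M.keys_eq).2 ⟨_, M.mem_run h he⟩

theorem exists_occ (M : Model C lab s occ) (h : Run s σ K) {i : ℕ} {α : Lab N} (hi : (i, α) ∈ σ) :
    ∃ e, lab e = α ∧ occ K e i := by
  induction h with
  | nil => cases hi
  | snoc h h' ih =>
    obtain ⟨e₀, he₀, -, H⟩ := M.step h h'
    rcases List.mem_cons.1 hi with hi | hi
    · cases hi; exact ⟨e₀, he₀, (H _ _).2 (.inr ⟨rfl, rfl⟩)⟩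
    · obtain ⟨e, he, h⟩ := ih hi
      exact ⟨e, he, (H _ _).2 (.inl h)⟩

theorem event_unique (M : Model C lab s occ) (h : Run s σ K) {e e' : E} {i : ℕ} (he : occ K e i)
    (he' : occ K e' i) : e = e' := by
  induction h with
  | nil => exact absurd he (M.start e i)
  | snoc h h' ih =>
    obtain ⟨e₀, -, -, H⟩ := M.step h h'
    rcases (H _ _).1 he with h₁ | ⟨rfl, rfl⟩ <;> rcases (H _ _).1 he' with h₂ | ⟨h₂, h₃⟩
    · exact ih h₁ h₂
    · exact absurd (M.mem_keys h h₁) (h₃ ▸ h'.keys_fwd.1)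
    · exact absurd (M.mem_keys h h₂) h'.keys_fwd.1
    · exact h₂.symm

theorem key_unique (M : Model C lab s occ) (h : Run s σ K) {e : E} {i j : ℕ} (he : occ K e i)
    (he' : occ K e j) : i = j := by
  induction h with
  | nil => exact absurd he (M.start e i)
  | snoc h h' ih =>
    obtain ⟨e₀, -, h₀, H⟩ := M.step h h'
    rcases (H _ _).1 he with h₁ | ⟨rfl, rfl⟩ <;> rcases (H _ _).1 he' with h₂ | ⟨h₂, h₃⟩
    · exact ih h₁ h₂
    · exact absurd h₁ (h₂ ▸ h₀ _)
    · exact absurd h₂ (h₀ _)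
    · exact h₃.symm

/-- Runs reach finite sets of events. -/
theorem finite_events {f : E → Option (Lab N)} (start : ∀ e i, ¬ occ s e i)
    (step : ∀ {σ K i α K'}, Run s σ K → Tr .fwd K i α K' → ∃ e, f e = some α ∧
      (∀ j, ¬occ K e j) ∧ ∀ e' j, occ K' e' j ↔ occ K e' j ∨ (e' = e ∧ j = i))
    (h : Run s σ K) : (events occ K).Finite := by
  induction h with
  | nil => convert Set.finite_empty (α := E); ext; simp [events, start]
  | snoc h h' ih =>
    obtain ⟨e₀, -, -, H⟩ := step h h'
    refine (ih.insert e₀).subset ?_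
    rintro e ⟨i, hi⟩
    rcases (H _ _).1 hi with h₁ | ⟨rfl, -⟩
    · exact .inr ⟨_, h₁⟩
    · exact .inl rfl

/-- Two different events of a run are separated by an earlier state of the run. -/
theorem separate {f : E → Option (Lab N)} (start : ∀ e i, ¬ occ s e i)
    (step : ∀ {σ K i α K'}, Run s σ K → Tr .fwd K i α K' → ∃ e, f e = some α ∧
      (∀ j, ¬ occ K e j) ∧ ∀ e' j, occ K' e' j ↔ occ K e' j ∨ (e' = e ∧ j = i))
    (h : Run s σ K) {e e' : E} (he : e ∈ events occ K) (he' : e' ∈ events occ K)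
    (hne : e ≠ e') : ∃ τ L, Run s τ L ∧ events occ L ⊆ events occ K ∧
      (e ∈ events occ L ↔ e' ∉ events occ L) := by
  induction h with
  | nil => exact absurd he.choose_spec (start _ _)
  | snoc h h' ih =>
    obtain ⟨e₀, -, h₀, H⟩ := step h h'
    have hsub : events occ _ ⊆ events occ _ := fun e he => ⟨_, (H e _).2 (.inl he.choose_spec)⟩
    obtain ⟨i, hi⟩ := id he
    obtain ⟨j, hj⟩ := id he'
    rcases (H _ _).1 hi with h₁ | ⟨rfl, -⟩ <;> rcases (H _ _).1 hj with h₂ | ⟨h₂, -⟩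
    · obtain ⟨τ, L, hL, hLK, hsep⟩ := ih ⟨_, h₁⟩ ⟨_, h₂⟩
      exact ⟨τ, L, hL, hLK.trans hsub, hsep⟩
    · refine ⟨_, _, h, hsub, iff_of_true ⟨_, h₁⟩ ?_⟩
      rintro ⟨j, hj⟩
      exact h₀ j (h₂ ▸ hj)
    · refine ⟨_, _, h, hsub, iff_of_false ?_ (not_not.2 ⟨_, h₂⟩)⟩
      rintro ⟨j, hj⟩
      exact h₀ j hj
    · exact absurd h₂.symm hne

theorem nil (C : Set (Set PEmpty)) (lab : PEmpty → Lab N) (hC : ∅ ∈ C) :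
    Model C lab .nil (fun _ _ _ => False) where
  keys_eq := rfl
  start := by simp
  step h h' := by cases h.nil_inv; cases h'
  conf h := by simpa [events] using hC

theorem res (M : Model C lab s occ) (a : N) {S : Set (Lab N)}
    (hS : S = {.vis (.name a), .vis (.coname a)}) :
    Model (E := {e : E // e ∉ {e | lab e ∈ S}}) {x | Subtype.val '' x ∈ C} (fun e => lab e.1)
      (.res s a) (fun T e i => ∃ K, T = .res K a ∧ occ K e.1 i) where
  keys_eq := M.keys_eq
  start := by
    rintro e i ⟨K, ⟨⟩, h⟩
    exact M.start _ _ h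
  step h h' := by
    obtain ⟨K, rfl, hK, -⟩ := h.res_inv
    cases h' with
    | res h' hn hc =>
      obtain ⟨e, rfl, h₀, H⟩ := M.step hK h'
      refine ⟨⟨e, by simp [hS, hn, hc]⟩, rfl, ?_, ?_⟩
      · rintro j ⟨K, ⟨⟩, h⟩
        exact h₀ j h
      · rintro ⟨e', he'⟩ j
        simp [H]
  conf h := by
    obtain ⟨K, rfl, hK, Hσ⟩ := h.res_inv
    rw [Set.mem_ofPred_eq]
    convert M.conf hK using 1
    ext e
    constructor
    · rintro ⟨e, ⟨i, K, ⟨⟩, h⟩, rfl⟩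
      exact ⟨i, h⟩
    · rintro ⟨i, h⟩
      exact ⟨⟨e, by simpa [hS] using Hσ _ _ (M.mem_run hK h)⟩, ⟨i, K, rfl, h⟩, rfl⟩

/-- The events that have occurred in a guarded sum; `none` is the event of the first prefix. -/
def sumOcc (occ : Keyed N → E → ℕ → Prop) (occ' : Keyed N → E' → ℕ → Prop) :
    Keyed N → Option E ⊕ E' → ℕ → Prop
  | .cons _ _ t, .inr e, i => occ' t e i
  | .fired j _ _ _, .inl none, i => i = j
  | .fired _ _ X _, .inl (some e), i => occ X e i
  | _, _, _ => False

theorem cons (M : Model C lab s occ) (M' : Model C' lab' t occ') (l : Vis N)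
    {D : Set (Set (Option E ⊕ E'))} (h₁ : ∀ y ∈ C, Sum.inl '' insert none (some '' y) ∈ D)
    (h₂ : ∀ y ∈ C', Sum.inr '' y ∈ D) :
    Model D (Sum.elim (fun e => e.elim (.vis l) lab) lab') (.cons l s t) (sumOcc occ occ') where
  keys_eq := by simp [Keyed.keys, M.keys_eq, M'.keys_eq]
  start := by
    rintro ((_ | e) | e) i <;> simp [sumOcc, M'.start]
  step h h' := by
    rcases h.cons_inv with ⟨t', rfl, ht⟩ | ⟨j, X, τ, rfl, hX⟩
    · cases h' with
      | fire hs ht' =>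
        obtain rfl : t' = t := by
          cases ht with
          | nil => rfl
          | snoc _ h => exact absurd (h.keys_fwd.2.symm.trans ht') (Set.insert_nonempty _ _).ne_empty
        refine ⟨.inl none, rfl, by simp [sumOcc], ?_⟩
        rintro ((_ | e) | e) j <;> simp [sumOcc, M.start, M'.start]
      | rest _ h =>
        obtain ⟨e, rfl, h₀, H⟩ := M'.step ht h
        refine ⟨.inr e, rfl, by simpa [sumOcc] using h₀, ?_⟩
        rintro ((_ | e) | e) j <;> simp [sumOcc, H]
    · cases h' with
      | under _ _ h =>
        obtain ⟨e, rfl, h₀, H⟩ := M.step hX h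
        refine ⟨.inl (some e), rfl, by simpa [sumOcc] using h₀, ?_⟩
        rintro ((_ | e) | e) j <;> simp [sumOcc, H]
  conf h := by
    rcases h.cons_inv with ⟨t', rfl, ht⟩ | ⟨j, X, τ, rfl, hX⟩
    · convert h₂ _ (M'.conf ht) using 1
      ext ((_ | e) | e) <;> simp [sumOcc, events]
    · convert h₁ _ (M.conf hX) using 1
      ext ((_ | e) | e) <;> simp [sumOcc, events]

/-- The events that have occurred in a parallel composition: synchronized events are those that
have occurred with the same key. -/
def parOcc (occ : Keyed N → E → ℕ → Prop) (occ' : Keyed N → E' → ℕ → Prop) :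
    Keyed N → PartialProd E E' → ℕ → Prop
  | .par K L, .left a, i => occ K a i ∧ i ∉ L.keys
  | .par K L, .right b, i => occ' L b i ∧ i ∉ K.keys
  | .par K L, .both a b, i => occ K a i ∧ occ' L b i
  | _, _, _ => False

/-- The label, or `⊥`, of an event of the product. -/
noncomputable def syncLab (lab : E → Lab N) (lab' : E' → Lab N) (e : PartialProd E E') :
    Option (Lab N) :=
  sync (e.map lab lab')

theorem parOcc_start (M : Model C lab s occ) (M' : Model C' lab' t occ') (e : PartialProd E E')
    (i : ℕ) : ¬ parOcc occ occ' (.par s t) e i := by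
  cases e <;> simp [parOcc, M.start, M'.start]

theorem parOcc_step (M : Model C lab s occ) (M' : Model C' lab' t occ') {T T' : Keyed N} {i : ℕ}
    {α : Lab N} (h : Run (.par s t) σ T) (h' : Tr .fwd T i α T') :
    ∃ e : PartialProd E E', syncLab lab lab' e = some α ∧ (∀ j, ¬ parOcc occ occ' T e j) ∧
      ∀ e' j, parOcc occ occ' T' e' j ↔ parOcc occ occ' T e' j ∨ (e' = e ∧ j = i) := by
  obtain ⟨K, L, σ₁, σ₂, rfl, hK, hL, -⟩ := h.par_inv M.keys_eq M'.keys_eq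
  cases h' with
  | @syn _ _ l _ K' _ L' h₁ h₂ =>
    obtain ⟨a, ha, ha₀, Ha⟩ := M.step hK h₁
    obtain ⟨b, hb, hb₀, Hb⟩ := M'.step hL h₂
    refine ⟨.both a b, by simp [syncLab, PartialProd.map, sync, ha, hb],
      fun j h => ha₀ j h.1, ?_⟩
    have hi := h₁.keys_fwd
    have hi' := h₂.keys_fwd
    have k₁ : ∀ a, occ K a i → False := fun a h => hi.1 (M.mem_keys hK h)
    have k₂ : ∀ b, occ' L b i → False := fun b h => hi'.1 (M'.mem_keys hL h)
    rintro (_ | _ | _) j <;> simp [parOcc, Ha, Hb, hi.2, hi'.2] <;> grind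
  | @parL _ _ _ _ K' _ h₁ hi' =>
    obtain ⟨a, ha, ha₀, Ha⟩ := M.step hK h₁
    refine ⟨.left a, by simp [syncLab, PartialProd.map, sync, ha], fun j h => ha₀ j h.1, ?_⟩
    have hi := h₁.keys_fwd
    have k₂ : ∀ b, occ' L b i → False := fun b h => hi' (M'.mem_keys hL h)
    rintro (_ | _ | _) j <;> simp [parOcc, Ha, hi.2] <;> grind
  | @parR _ _ _ _ _ L' h₁ hi' =>
    obtain ⟨b, hb, hb₀, Hb⟩ := M'.step hL h₁
    refine ⟨.right b, by simp [syncLab, PartialProd.map, sync, hb], fun j h => hb₀ j h.1, ?_⟩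
    have hi := h₁.keys_fwd
    have k₁ : ∀ a, occ K a i → False := fun a h => hi' (M.mem_keys hK h)
    rintro (_ | _ | _) j <;> simp [parOcc, Hb, hi.2] <;> grind

/-- Events of a run of a parallel composition are not labelled by `⊥`. -/
theorem syncLab_ne_none (M : Model C lab s occ) (M' : Model C' lab' t occ') {T : Keyed N}
    (h : Run (.par s t) σ T) {e : PartialProd E E'} (he : e ∈ events (parOcc occ occ') T) :
    syncLab lab lab' e ≠ none := by
  obtain ⟨i, he⟩ := he
  induction h with
  | nil => exact absurd he (M.parOcc_start M' _ _)
  | snoc h h' ih =>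
    obtain ⟨e₀, he₀, -, H⟩ := M.parOcc_step M' h h'
    rcases (H _ _).1 he with h | ⟨rfl, -⟩
    · exact ih h
    · simp [he₀]

/-- The events of a parallel composition project onto those of the components. -/
theorem parOcc_proj (M : Model C lab s occ) (M' : Model C' lab' t occ') {T : Keyed N}
    (h : Run (.par s t) σ T) :
    proj₁ (events (parOcc occ occ') T) ∈ C ∧ proj₂ (events (parOcc occ occ') T) ∈ C' := by
  obtain ⟨K, L, σ₁, σ₂, rfl, hK, hL, -⟩ := h.par_inv M.keys_eq M'.keys_eq
  constructor
  · convert M.conf hK using 1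
    ext a
    constructor
    · rintro ⟨_ | _ | _, ⟨i, hi⟩, hea⟩ <;> cases hea <;> exact ⟨i, hi.1⟩
    · rintro ⟨i, hi⟩
      by_cases hiL : i ∈ L.keys
      · obtain ⟨β, hβ⟩ := (hL.mem_keys M'.keys_eq).1 hiL
        obtain ⟨b, -, hb⟩ := M'.exists_occ hL hβ
        exact ⟨.both a b, ⟨i, hi, hb⟩, rfl⟩
      · exact ⟨.left a, ⟨i, hi, hiL⟩, rfl⟩
  · convert M'.conf hL using 1
    ext b
    constructor
    · rintro ⟨_ | _ | _, ⟨i, hi⟩, hea⟩ <;> cases hea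
      exacts [⟨i, hi.1⟩, ⟨i, hi.2⟩]
    · rintro ⟨i, hi⟩
      by_cases hiK : i ∈ K.keys
      · obtain ⟨α, hα⟩ := (hK.mem_keys M.keys_eq).1 hiK
        obtain ⟨a, -, ha⟩ := M.exists_occ hK hα
        exact ⟨.both a b, ⟨i, ha, hi⟩, rfl⟩
      · exact ⟨.right b, ⟨i, hi, hiK⟩, rfl⟩

theorem parOcc_unique (M : Model C lab s occ) (M' : Model C' lab' t occ') {T : Keyed N}
    (h : Run (.par s t) σ T) {e e' : PartialProd E E'} {i j : ℕ} (he : parOcc occ occ' T e i)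
    (he' : parOcc occ occ' T e' j)
    (hee : (e.fst = e'.fst ∧ e.fst ≠ none) ∨ (e.snd = e'.snd ∧ e.snd ≠ none)) : e = e' := by
  obtain ⟨K, L, σ₁, σ₂, rfl, hK, hL, -⟩ := h.par_inv M.keys_eq M'.keys_eq
  have k₁ := fun a i => M.mem_keys hK (e := a) (i := i)
  have k₂ := fun b i => M'.mem_keys hL (e := b) (i := i)
  have u₁ := fun a i j => M.key_unique hK (e := a) (i := i) (j := j)
  have u₂ := fun b i j => M'.key_unique hL (e := b) (i := i) (j := j)
  have v₁ := fun a a' i => M.event_unique hK (e := a) (e' := a') (i := i)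
  have v₂ := fun b b' i => M'.event_unique hL (e := b) (e' := b') (i := i)
  cases e <;> cases e' <;> simp [PartialProd.fst, PartialProd.snd, parOcc] at hee he he' ⊢ <;>
    grind

/-- Runs of a parallel composition are configurations of the product. -/
theorem parOcc_mem_product (M : Model C lab s occ) (M' : Model C' lab' t occ') {T : Keyed N}
    (h : Run (.par s t) σ T) :
    events (parOcc occ occ') T ∈ (product (.mk E C lab) (.mk E' C' lab')).C := by
  have hp := M.parOcc_proj M' h
  refine ⟨hp.1, hp.2, ?_, ?_, ?_⟩
  · rintro e ⟨i, hi⟩ e' ⟨j, hj⟩ hee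
    exact M.parOcc_unique M' h hi hj hee
  · intro e he
    exact ⟨_, subset_rfl, finite_events (M.parOcc_start M') (M.parOcc_step M') h, hp.1, hp.2, he⟩
  · intro e he e' he' hne
    obtain ⟨τ, L, hL, hLT, hsep⟩ := separate (M.parOcc_start M') (M.parOcc_step M') h he he' hne
    have hp' := M.parOcc_proj M' hL
    exact ⟨_, hLT, hp'.1, hp'.2, hsep⟩

theorem par (M : Model C lab s occ) (M' : Model C' lab' t occ')
    {D : Set (Set {e : PartialProd E E' // syncLab lab lab' e ≠ none})}
    (hD : ∀ x (z : Set (PartialProd E E')), Subtype.val '' x = z →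
      z ∈ (product (.mk E C lab) (.mk E' C' lab')).C → x ∈ D)
    {labD : {e : PartialProd E E' // syncLab lab lab' e ≠ none} → Lab N}
    (hlab : ∀ e, syncLab lab lab' e.1 = some (labD e)) :
    Model D labD (.par s t) (fun T e i => parOcc occ occ' T e.1 i) where
  keys_eq := by simp [Keyed.keys, M.keys_eq, M'.keys_eq]
  start e i := M.parOcc_start M' e.1 i
  step h h' := by
    obtain ⟨e, he, h₀, H⟩ := M.parOcc_step M' h h'
    refine ⟨⟨e, by simp [he]⟩, ?_, h₀, fun e' j => ?_⟩
    · exact Option.some_injective _ ((hlab _).symm.trans he)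
    · rw [← Subtype.coe_inj]
      exact H _ _
  conf h := by
    refine hD _ _ ?_ (M.parOcc_mem_product M' h)
    ext e
    constructor
    · rintro ⟨e, ⟨i, hi⟩, rfl⟩
      exact ⟨i, hi⟩
    · rintro he
      exact ⟨⟨e, M.syncLab_ne_none M' h he⟩, he, rfl⟩

end Model

end ConfStr

section

variable {N : Type u}

open ConfStr

mutual

/-- The encoding of a CCS process models the process. -/
theorem CCS.exists_model : (P : CCS N) → ∃ occ, Model P.encode.C P.encode.lab P.emb occ
  | .par P Q => by
    obtain ⟨occ, M⟩ := CCS.exists_model P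
    obtain ⟨occ', M'⟩ := CCS.exists_model Q
    exact ⟨_, M.par M' (D := (ConfStr.par P.encode Q.encode).C)
      (labD := (ConfStr.par P.encode Q.encode).lab) (by rintro x _ rfl hx; exact hx)
      (fun e => (Option.some_get _).symm)⟩
  | .sum G => Guarded.exists_model G
  | .res P a => by
    obtain ⟨occ, M⟩ := CCS.exists_model P
    exact ⟨_, M.res a rfl⟩

/-- The encoding of a guarded sum models the sum. -/
theorem Guarded.exists_model : (G : Guarded N) → ∃ occ, Model G.encode.C G.encode.lab G.emb occ
  | .nil => ⟨_, .nil _ _ rfl⟩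
  | .cons l P Q => by
    obtain ⟨occ, M⟩ := CCS.exists_model P
    obtain ⟨occ', M'⟩ := Guarded.exists_model Q
    exact ⟨_, M.cons M' l (D := (ConfStr.choice (.pre (.vis l) P.encode) Q.encode).C)
      (fun y hy => .inl ⟨_, .inr ⟨y, hy, rfl⟩, rfl⟩) (fun y hy => .inr ⟨y, hy, rfl⟩)⟩

end

/-- Two backward transitions of one process with the same label and different keys undo two
concurrent events with the same label. Hence they do not exist without auto-concurrency. -/
theorem ConfStr.WithoutAutoConcurrency.key_unique {P : CCS N}
    (hP : P.encode.WithoutAutoConcurrency) {σ : List (ℕ × Lab N)} {K K₀ K₁ : Keyed N} {i k : ℕ}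
    {α : Lab N} (h : Keyed.Run P.emb σ K) (h₀ : Keyed.Tr .bwd K i α K₀)
    (h₁ : Keyed.Tr .bwd K k α K₁) : i = k := by
  obtain ⟨occ, M⟩ := P.exists_model
  by_contra hne
  obtain ⟨σ₁, σ₂, -, hσ, -⟩ := h.bwd M.keys_eq h₀
  obtain ⟨τ₁, τ₂, -, hτ, -⟩ := h.bwd M.keys_eq h₁
  obtain ⟨e, he, he₀, He⟩ := M.step hσ h₀.flip
  obtain ⟨d, hd, hd₀, Hd⟩ := M.step hτ h₁.flip
  have hei : occ K e i := (He _ _).2 (.inr ⟨rfl, rfl⟩)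
  have hdk : occ K d k := (Hd _ _).2 (.inr ⟨rfl, rfl⟩)
  have hde : d ≠ e := by
    rintro rfl
    exact hne (M.key_unique h hei hdk)
  refine hde (hP _ (M.conf h) d ⟨k, hdk⟩ e ⟨i, hei⟩ ?_ (hd.trans he.symm))
  rintro (⟨hle, -⟩ | ⟨hle, -⟩)
  · obtain ⟨j, hj⟩ := hle _ (M.conf hτ) (fun x hx => ⟨_, (Hd _ _).2 (.inl hx.choose_spec)⟩)
      ⟨i, ((Hd _ _).1 hei).resolve_right fun h => hde h.1.symm⟩
    exact hd₀ j hj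
  · obtain ⟨j, hj⟩ := hle _ (M.conf hσ) (fun x hx => ⟨_, (He _ _).2 (.inl hx.choose_spec)⟩)
      ⟨k, ((He _ _).1 hdk).resolve_right fun h => hde h.1⟩
    exact he₀ j hj

end

/-! ### Matching occurrences of labels -/

namespace Keyed

variable {N : Type u}

open Classical in
/-- The keys of the transitions of a run that are labelled by `α`, the most recent one first. -/
noncomputable def keysOf (α : Lab N) (σ : List (ℕ × Lab N)) : List ℕ :=
  σ.filterMap fun p => if p.2 = α then some p.1 else none

theorem mem_keysOf {α : Lab N} {σ : List (ℕ × Lab N)} {i : ℕ} :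
    i ∈ keysOf α σ ↔ (i, α) ∈ σ := by
  simp [keysOf]

theorem keysOf_sublist (α : Lab N) (σ : List (ℕ × Lab N)) :
    (keysOf α σ).Sublist (σ.map Prod.fst) := by
  induction σ with
  | nil => exact .slnil
  | cons p σ ih =>
    by_cases h : p.2 = α
    · simpa [keysOf, List.filterMap_cons, h] using ih
    · simpa [keysOf, List.filterMap_cons, h] using ih.cons p.1

/-- The run `τ` has one more transition than `σ`, with key `i`, label `α`, and after all other
transitions with this label. -/
def Extends (α : Lab N) (i : ℕ) (σ τ : List (ℕ × Lab N)) : Prop :=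
  keysOf α τ = i :: keysOf α σ ∧ ∀ β, β ≠ α → keysOf β τ = keysOf β σ

theorem extends_cons (α : Lab N) (i : ℕ) (σ : List (ℕ × Lab N)) :
    Extends α i σ ((i, α) :: σ) := by
  refine ⟨by simp [keysOf], fun β hβ => ?_⟩
  simp [keysOf, hβ.symm]

theorem Extends.mem_iff {α β : Lab N} {i j : ℕ} {σ τ : List (ℕ × Lab N)} (h : Extends α i σ τ) :
    (j, β) ∈ τ ↔ (j = i ∧ β = α) ∨ (j, β) ∈ σ := by
  rw [← mem_keysOf, ← mem_keysOf]
  by_cases hβ : β = α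
  · subst hβ; simp [h.1]
  · simp [h.2 β hβ, hβ]

/-- Without auto-concurrency, only the last transition with a given label can be undone. -/
theorem Run.extends_of_bwd {P : CCS N} (hP : P.encode.WithoutAutoConcurrency)
    {K K₀ : Keyed N} {σ : List (ℕ × Lab N)} {i : ℕ} {α : Lab N} (h : Run P.emb σ K)
    (h₀ : Tr .bwd K i α K₀) : ∃ σ₀, Run P.emb σ₀ K₀ ∧ Extends α i σ₀ σ := by
  obtain ⟨σ₁, σ₂, rfl, hσ, H⟩ := h.bwd P.keys_emb h₀
  refine ⟨_, hσ, ?_, fun β hβ => ?_⟩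
  · have : keysOf α σ₁ = [] := by
      rw [List.eq_nil_iff_forall_not_mem]
      intro k hk
      obtain ⟨hne, τ, L, L₀, L₁, hL, hL₀, hL₁⟩ := H _ _ (mem_keysOf.1 hk)
      exact hne (hP.key_unique hL hL₁ hL₀)
    simp only [keysOf] at this ⊢
    simp [this]
  · simp [keysOf, hβ.symm]

/-- The partial function `f` sends the `n`-th transition labelled by `α` in the first run to the
`n`-th one in the second run, for all labels `α` and all `n`. -/
structure Matches (σ τ : List (ℕ × Lab N)) (f : ℕ → Option ℕ) : Prop where
  map_eq : ∀ α, (keysOf α σ).map f = (keysOf α τ).map some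
  eq_none : ∀ i, (∀ α, (i, α) ∉ σ) → f i = none

namespace Matches

variable {σ σ' τ τ' : List (ℕ × Lab N)} {f : ℕ → Option ℕ} {i j : ℕ} {α : Lab N}

theorem nil : Matches (N := N) [] [] (fun _ => none) :=
  ⟨by simp [keysOf], by simp⟩

theorem map_update (x : Option ℕ) (hi : ∀ β, (i, β) ∉ σ) (β : Lab N) :
    (keysOf β σ).map (Function.update f i x) = (keysOf β σ).map f := by
  refine List.map_congr_left fun k hk => Function.update_of_ne ?_ _ _
  rintro rfl
  exact hi β (mem_keysOf.1 hk)

theorem extend (h : Matches σ τ f) (hσ : Extends α i σ σ') (hτ : Extends α j τ τ')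
    (hi : ∀ β, (i, β) ∉ σ) : Matches σ' τ' (Function.update f i (some j)) := by
  constructor
  · intro β
    by_cases hβ : β = α
    · subst hβ
      simp [hσ.1, hτ.1, map_update _ hi, h.map_eq]
    · rw [hσ.2 β hβ, hτ.2 β hβ, map_update _ hi, h.map_eq]
  · intro k hk
    have hki : k ≠ i := by
      rintro rfl
      exact hk α (hσ.mem_iff.2 (.inl ⟨rfl, rfl⟩))
    rw [Function.update_of_ne hki]
    exact h.eq_none k fun β hβ => hk β (hσ.mem_iff.2 (.inr hβ))

theorem restrict (h : Matches σ' τ' f) (hσ : Extends α i σ σ') (hτ : Extends α j τ τ')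
    (hi : ∀ β, (i, β) ∉ σ) : f i = some j ∧ Matches σ τ (Function.update f i none) := by
  have hα := h.map_eq α
  rw [hσ.1, hτ.1, List.map_cons, List.map_cons, List.cons.injEq] at hα
  refine ⟨hα.1, fun β => ?_, fun k hk => ?_⟩
  · rw [map_update _ hi]
    by_cases hβ : β = α
    · subst hβ
      exact hα.2
    · rw [← hσ.2 β hβ, ← hτ.2 β hβ, h.map_eq]
  · by_cases hki : k = i
    · simp [hki]
    · rw [Function.update_of_ne hki]
      exact h.eq_none k fun β hβ => (hσ.mem_iff.1 hβ).elim (fun h => hki h.1) (hk β)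

theorem isBijBetween {s t K L : Keyed N} (h : Matches σ τ f) (hs : s.keys = ∅) (ht : t.keys = ∅)
    (hK : Run s σ K) (hL : Run t τ L) : RCCS.IsBijBetween f K.keys L.keys := by
  have key : ∀ i j, f i = some j → ∃ α, (i, α) ∈ σ ∧ (j, α) ∈ τ := by
    intro i j hij
    by_contra! hne
    by_cases hi : ∃ α, (i, α) ∈ σ
    · obtain ⟨α, hα⟩ := hi
      have := List.mem_map_of_mem (f := f) (mem_keysOf.2 hα)
      rw [h.map_eq, hij] at this
      exact hne α hα (mem_keysOf.1 (by simpa using this))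
    · rw [h.eq_none i (not_exists.1 hi)] at hij
      cases hij
  refine ⟨fun i => ?_, fun j => ?_, fun i i' j hi hi' => ?_⟩
  · rw [hK.mem_keys hs]
    constructor
    · rintro ⟨α, hα⟩
      have := List.mem_map_of_mem (f := f) (mem_keysOf.2 hα)
      rw [h.map_eq, List.mem_map] at this
      obtain ⟨j, -, hj⟩ := this
      exact ⟨j, hj.symm⟩
    · rintro ⟨j, hj⟩
      obtain ⟨α, hα, -⟩ := key i j hj
      exact ⟨α, hα⟩
  · rw [hL.mem_keys ht]
    constructor
    · rintro ⟨α, hα⟩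
      have := List.mem_map_of_mem (f := some) (mem_keysOf.2 hα)
      rw [← h.map_eq, List.mem_map] at this
      obtain ⟨i, -, hi⟩ := this
      exact ⟨i, hi⟩
    · rintro ⟨i, hi⟩
      obtain ⟨α, -, hα⟩ := key i j hi
      exact ⟨α, hα⟩
  · obtain ⟨α, hα, hj⟩ := key i j hi
    obtain ⟨β, hβ, hj'⟩ := key i' j hi'
    obtain rfl : α = β :=
      congrArg Prod.snd (List.inj_on_of_nodup_map (hL.nodup ht) hj hj' rfl)
    have hn : ((keysOf α σ).map f).Nodup := by
      rw [h.map_eq]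
      exact ((hL.nodup ht).sublist (keysOf_sublist α τ)).map (Option.some_injective _)
    exact List.inj_on_of_nodup_map hn (mem_keysOf.2 hα) (mem_keysOf.2 hβ) (hi.trans hi'.symm)

end Matches

end Keyed

/-! ### Collapse of the two bisimulations -/

namespace RCCS

variable {N : Type u} [DecidableEq N]

open Keyed

theorem IsOrigin.exists_run {P : CCS N} {R : RCCS N} (h : IsOrigin P R) :
    ∃ σ K, Sim R K ∧ Run P.emb σ K := by
  induction h with
  | refl => exact ⟨_, _, sim_start P, .nil⟩
  | tail _ h ih =>
    obtain ⟨σ, K, hK, hσ⟩ := ih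
    rcases h with h | ⟨d, i, α, h⟩
    · exact ⟨σ, K, h.repC hK, hσ⟩
    · obtain ⟨K', hK', hS⟩ := hK.tr h
      cases d with
      | fwd => exact ⟨_, _, hS, .snoc hσ hK'⟩
      | bwd =>
        obtain ⟨σ₁, σ₂, -, hσ', -⟩ := hσ.bwd P.keys_emb hK'
        exact ⟨_, _, hS, hσ'⟩

theorem IsBF.isSBF {O₁ O₂ : CCS N} {Rel : RCCS N → RCCS N → (ℕ → Option ℕ) → Prop}
    (h : IsBF O₁ O₂ Rel) : IsSBF O₁ O₂ (fun R₁ R₂ => ∃ f, Rel R₁ R₂ f) where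
  start := ⟨_, h.start⟩
  forth₁ := fun R₁ R₂ ⟨f, hf⟩ i α S₁ hs =>
    let ⟨j, S₂, hs', hr⟩ := h.forth₁ R₁ R₂ f hf i α S₁ hs
    ⟨j, S₂, hs', _, hr⟩
  forth₂ := fun R₁ R₂ ⟨f, hf⟩ i α S₁ hs =>
    let ⟨j, S₂, hs', hr⟩ := h.forth₂ R₁ R₂ f hf i α S₁ hs
    ⟨j, S₂, hs', _, hr⟩
  back₁ := fun R₁ R₂ ⟨f, hf⟩ i α S₁ hs =>
    let ⟨j, S₂, hs', _, hr⟩ := h.back₁ R₁ R₂ f hf i α S₁ hs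
    ⟨j, S₂, hs', _, hr⟩
  back₂ := fun R₁ R₂ ⟨f, hf⟩ i α S₁ hs =>
    let ⟨j, S₂, hs', _, hr⟩ := h.back₂ R₁ R₂ f hf i α S₁ hs
    ⟨j, S₂, hs', _, hr⟩

/-- The refinement of a relation between reversible processes by the partial function that matches
the `n`-th occurrences of each label. -/
def Lift (O₁ O₂ : CCS N) (Rel : RCCS N → RCCS N → Prop) (R₁ R₂ : RCCS N) (f : ℕ → Option ℕ) :
    Prop :=
  Rel R₁ R₂ ∧ ∃ K₁ K₂ σ₁ σ₂, Sim R₁ K₁ ∧ Sim R₂ K₂ ∧ Run O₁.emb σ₁ K₁ ∧ Run O₂.emb σ₂ K₂ ∧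
    Matches σ₁ σ₂ f

namespace Lift

variable {O₁ O₂ : CCS N} {Rel : RCCS N → RCCS N → Prop} {R₁ R₂ S₁ S₂ : RCCS N}
  {f : ℕ → Option ℕ} {i j : ℕ} {α : Lab N}

theorem fwd (h : Lift O₁ O₂ Rel R₁ R₂ f) (hR : Step .fwd R₁ i α S₁) (hS : Step .fwd R₂ j α S₂)
    (hr : Rel S₁ S₂) : Lift O₁ O₂ Rel S₁ S₂ (Function.update f i (some j)) := by
  obtain ⟨-, K₁, K₂, σ₁, σ₂, hK₁, hK₂, hσ₁, hσ₂, hf⟩ := h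
  obtain ⟨L₁, hL₁, hS₁⟩ := hK₁.tr hR
  obtain ⟨L₂, hL₂, hS₂⟩ := hK₂.tr hS
  refine ⟨hr, L₁, L₂, _, _, hS₁, hS₂, .snoc hσ₁ hL₁, .snoc hσ₂ hL₂,
    hf.extend (extends_cons _ _ _) (extends_cons _ _ _) ?_⟩
  rw [← not_exists, ← hσ₁.mem_keys O₁.keys_emb]
  exact hL₁.keys_fwd.1

theorem bwd (h₁ : O₁.encode.WithoutAutoConcurrency) (h₂ : O₂.encode.WithoutAutoConcurrency)
    (h : Lift O₁ O₂ Rel R₁ R₂ f) (hR : Step .bwd R₁ i α S₁) (hS : Step .bwd R₂ j α S₂)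
    (hr : Rel S₁ S₂) : f i = some j ∧ Lift O₁ O₂ Rel S₁ S₂ (Function.update f i none) := by
  obtain ⟨-, K₁, K₂, σ₁, σ₂, hK₁, hK₂, hσ₁, hσ₂, hf⟩ := h
  obtain ⟨L₁, hL₁, hS₁⟩ := hK₁.tr hR
  obtain ⟨L₂, hL₂, hS₂⟩ := hK₂.tr hS
  obtain ⟨τ₁, hτ₁, he₁⟩ := hσ₁.extends_of_bwd h₁ hL₁
  obtain ⟨τ₂, hτ₂, he₂⟩ := hσ₂.extends_of_bwd h₂ hL₂
  have hi : ∀ β, (i, β) ∉ τ₁ := by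
    rw [← not_exists, ← hτ₁.mem_keys O₁.keys_emb]
    exact hL₁.keys_bwd.1
  have := hf.restrict he₁ he₂ hi
  exact ⟨this.1, hr, L₁, L₂, _, _, hS₁, hS₂, hτ₁, hτ₂, this.2⟩

end Lift

theorem IsSBF.isBF_lift {O₁ O₂ : CCS N} {Rel : RCCS N → RCCS N → Prop} (h : IsSBF O₁ O₂ Rel)
    (h₁ : O₁.encode.WithoutAutoConcurrency) (h₂ : O₂.encode.WithoutAutoConcurrency) :
    IsBF O₁ O₂ (Lift O₁ O₂ Rel) where
  start := ⟨h.start, _, _, [], [], sim_start O₁, sim_start O₂, .nil, .nil, .nil⟩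
  bij := by
    rintro R₁ R₂ f ⟨-, K₁, K₂, σ₁, σ₂, hK₁, hK₂, hσ₁, hσ₂, hf⟩
    rw [hK₁.ids_eq, hK₂.ids_eq]
    exact hf.isBijBetween O₁.keys_emb O₂.keys_emb hσ₁ hσ₂
  forth₁ R₁ R₂ f hf i α S₁ hs := by
    obtain ⟨j, S₂, hs', hr⟩ := h.forth₁ _ _ hf.1 i α S₁ hs
    exact ⟨j, S₂, hs', hf.fwd hs hs' hr⟩
  forth₂ R₁ R₂ f hf j α S₂ hs := by
    obtain ⟨i, S₁, hs', hr⟩ := h.forth₂ _ _ hf.1 j α S₂ hs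
    exact ⟨i, S₁, hs', hf.fwd hs' hs hr⟩
  back₁ R₁ R₂ f hf i α S₁ hs := by
    obtain ⟨j, S₂, hs', hr⟩ := h.back₁ _ _ hf.1 i α S₁ hs
    exact ⟨j, S₂, hs', hf.bwd h₁ h₂ hs hs' hr⟩
  back₂ R₁ R₂ f hf j α S₂ hs := by
    obtain ⟨i, S₁, hs', hr⟩ := h.back₂ _ _ hf.1 j α S₂ hs
    exact ⟨i, S₁, hs', hf.bwd h₁ h₂ hs' hs hr⟩

/-- Processes related by a simple back-and-forth bisimulation have matching runs. A run of the first
process is undone step by step, and the second process follows. -/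
theorem IsSBF.exists_matches [Infinite N] {O₁ O₂ : CCS N} {Rel : RCCS N → RCCS N → Prop}
    (h : IsSBF O₁ O₂ Rel) (h₂ : O₂.encode.WithoutAutoConcurrency) {R₁ R₂ : RCCS N}
    {K₁ K₂ : Keyed N} {σ₁ σ₂ : List (ℕ × Lab N)} (hr : Rel R₁ R₂) (hK₁ : Sim R₁ K₁)
    (hK₂ : Sim R₂ K₂) (hσ₁ : Run O₁.emb σ₁ K₁) (hσ₂ : Run O₂.emb σ₂ K₂) :
    ∃ f, Matches σ₁ σ₂ f := by
  induction hσ₁ generalizing R₁ R₂ K₂ σ₂ with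
  | nil =>
    cases hσ₂ with
    | nil => exact ⟨_, .nil⟩
    | snoc _ hs =>
      -- A nonempty second run could be undone, but the first process is at its origin.
      obtain ⟨S₂, hS₂, -⟩ := hK₂.step hs.flip
      obtain ⟨i, S₁, hS₁, -⟩ := h.back₂ _ _ hr _ _ _ hS₂
      obtain ⟨L, hL, -⟩ := hK₁.tr hS₁
      simpa [O₁.keys_emb] using hL.mem_keys_of_bwd
  | @snoc σ K K' i α hσ hs ih =>
    obtain ⟨S₁, hS₁, hK⟩ := hK₁.step hs.flip
    obtain ⟨j, S₂, hS₂, hr'⟩ := h.back₁ _ _ hr _ _ _ hS₁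
    obtain ⟨L₂, hL₂, hK₂'⟩ := hK₂.tr hS₂
    obtain ⟨τ, hτ, he⟩ := hσ₂.extends_of_bwd h₂ hL₂
    obtain ⟨f, hf⟩ := ih hr' hK hK₂' hτ
    refine ⟨_, hf.extend (extends_cons α i σ) he ?_⟩
    rw [← not_exists, ← hσ.mem_keys O₁.keys_emb]
    exact hs.keys_fwd.1

end RCCS

/-! ### The processes `a ∣ a` and `a.a` -/

namespace RCCS

variable {N : Type u}

open Keyed

/-- The keyed process of `a`. -/
def prefixK (a : N) : Keyed N := .cons (.name a) .nil .nil

/-- The keyed process of `a`, executed with key `i`. -/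
def firedK (a : N) (i : ℕ) : Keyed N := .fired i (.name a) .nil .nil

theorem tr_prefixK {a : N} {d : Dir} {i : ℕ} {α : Lab N} {K : Keyed N} :
    Tr d (prefixK a) i α K ↔ d = .fwd ∧ α = .vis (.name a) ∧ K = firedK a i := by
  constructor
  · rintro (_ | _ | ⟨_, h⟩)
    · exact ⟨rfl, rfl, rfl⟩
    · cases h
  · rintro ⟨rfl, rfl, rfl⟩
    exact .fire rfl rfl

theorem tr_firedK {a : N} {d : Dir} {i j : ℕ} {α : Lab N} {K : Keyed N} :
    Tr d (firedK a j) i α K ↔ d = .bwd ∧ i = j ∧ α = .vis (.name a) ∧ K = prefixK a := by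
  constructor
  · rintro (_ | _ | _ | ⟨_, _, h⟩)
    · exact ⟨rfl, rfl, rfl, rfl⟩
    · cases h
  · rintro ⟨rfl, rfl, rfl, rfl⟩
    exact .unfire rfl rfl

theorem tr_cons_nil {l : Vis N} {P K : Keyed N} {d : Dir} {i : ℕ} {α : Lab N}
    (h : Tr d (.cons l P .nil) i α K) : d = .fwd ∧ α = .vis l ∧ K = .fired i l P .nil := by
  cases h with
  | fire => exact ⟨rfl, rfl, rfl⟩
  | rest _ h => cases h

@[simp] theorem keys_prefixK (a : N) : (prefixK a).keys = ∅ := by simp [prefixK, Keyed.keys]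

@[simp] theorem keys_firedK (a : N) (i : ℕ) : (firedK a i).keys = {i} := by
  simp [firedK, Keyed.keys]

/-- The states of `a ∣ a` and `a.a` are related if equally many actions were executed. -/
inductive SameCount (a : N) : Keyed N → Keyed N → Prop
  | zero : SameCount a (.par (prefixK a) (prefixK a)) (.cons (.name a) (prefixK a) .nil)
  | left (i j : ℕ) :
      SameCount a (.par (firedK a i) (prefixK a)) (.fired j (.name a) (prefixK a) .nil)
  | right (i j : ℕ) :
      SameCount a (.par (prefixK a) (firedK a i)) (.fired j (.name a) (prefixK a) .nil)
  | both {i i' j j' : ℕ} : i ≠ i' → j ≠ j' →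
      SameCount a (.par (firedK a i) (firedK a i')) (.fired j (.name a) (firedK a j') .nil)

theorem SameCount.tr_left {a : N} {K L K' : Keyed N} (h : SameCount a K L) {d : Dir} {i : ℕ}
    {α : Lab N} (hK : Tr d K i α K') : ∃ j L', Tr d L j α L' ∧ SameCount a K' L' := by
  cases h with
  | zero =>
    cases hK with
    | syn h h' =>
      obtain ⟨-, h, -⟩ := tr_prefixK.1 h
      obtain ⟨-, h', -⟩ := tr_prefixK.1 h'
      cases h; cases h'
    | parL h hi =>
      obtain ⟨rfl, rfl, rfl⟩ := tr_prefixK.1 h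
      exact ⟨i, _, .fire (keys_prefixK a) rfl, .left _ _⟩
    | parR h hi =>
      obtain ⟨rfl, rfl, rfl⟩ := tr_prefixK.1 h
      exact ⟨i, _, .fire (keys_prefixK a) rfl, .right _ _⟩
  | left i₀ j₀ =>
    cases hK with
    | syn h h' =>
      obtain ⟨rfl, -⟩ := tr_prefixK.1 h'
      obtain ⟨⟨⟩, -⟩ := tr_firedK.1 h
    | parL h hi =>
      obtain ⟨rfl, rfl, rfl, rfl⟩ := tr_firedK.1 h
      exact ⟨j₀, _, .unfire (keys_prefixK a) rfl, .zero⟩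
    | parR h hi =>
      obtain ⟨rfl, rfl, rfl⟩ := tr_prefixK.1 h
      exact ⟨j₀ + 1, _, .under rfl (Nat.succ_ne_self _) (tr_prefixK.2 ⟨rfl, rfl, rfl⟩),
        .both (Ne.symm (by simpa using hi)) (Nat.succ_ne_self _).symm⟩
  | right i₀ j₀ =>
    cases hK with
    | syn h h' =>
      obtain ⟨rfl, -⟩ := tr_prefixK.1 h
      obtain ⟨⟨⟩, -⟩ := tr_firedK.1 h'
    | parR h hi =>
      obtain ⟨rfl, rfl, rfl, rfl⟩ := tr_firedK.1 h
      exact ⟨j₀, _, .unfire (keys_prefixK a) rfl, .zero⟩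
    | parL h hi =>
      obtain ⟨rfl, rfl, rfl⟩ := tr_prefixK.1 h
      exact ⟨j₀ + 1, _, .under rfl (Nat.succ_ne_self _) (tr_prefixK.2 ⟨rfl, rfl, rfl⟩),
        .both (by simpa using hi) (Nat.succ_ne_self _).symm⟩
  | @both i₀ i₁ j₀ j₁ hi hj =>
    cases hK with
    | syn h h' =>
      obtain ⟨-, -, h, -⟩ := tr_firedK.1 h
      obtain ⟨-, -, h', -⟩ := tr_firedK.1 h'
      cases h; cases h'
    | parL h hi =>
      obtain ⟨rfl, rfl, rfl, rfl⟩ := tr_firedK.1 h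
      exact ⟨j₁, _, .under rfl hj.symm (tr_firedK.2 ⟨rfl, rfl, rfl, rfl⟩), .right _ _⟩
    | parR h hi =>
      obtain ⟨rfl, rfl, rfl, rfl⟩ := tr_firedK.1 h
      exact ⟨j₁, _, .under rfl hj.symm (tr_firedK.2 ⟨rfl, rfl, rfl, rfl⟩), .left _ _⟩

theorem SameCount.tr_right {a : N} {K L L' : Keyed N} (h : SameCount a K L) {d : Dir} {j : ℕ}
    {α : Lab N} (hL : Tr d L j α L') : ∃ i K', Tr d K i α K' ∧ SameCount a K' L' := by
  cases h with
  | zero =>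
    obtain ⟨rfl, rfl, rfl⟩ := tr_cons_nil hL
    exact ⟨j, _, .parL (tr_prefixK.2 ⟨rfl, rfl, rfl⟩) (by simp), .left _ _⟩
  | left i₀ j₀ =>
    cases hL with
    | unfire =>
      exact ⟨i₀, _, .parL (tr_firedK.2 ⟨rfl, rfl, rfl, rfl⟩) (by simp), .zero⟩
    | under _ hj h =>
      obtain ⟨rfl, rfl, rfl⟩ := tr_prefixK.1 h
      exact ⟨i₀ + 1, _, .parR (tr_prefixK.2 ⟨rfl, rfl, rfl⟩) (by simp),
        .both (Nat.succ_ne_self _).symm hj.symm⟩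
  | right i₀ j₀ =>
    cases hL with
    | unfire =>
      exact ⟨i₀, _, .parR (tr_firedK.2 ⟨rfl, rfl, rfl, rfl⟩) (by simp), .zero⟩
    | under _ hj h =>
      obtain ⟨rfl, rfl, rfl⟩ := tr_prefixK.1 h
      exact ⟨i₀ + 1, _, .parL (tr_prefixK.2 ⟨rfl, rfl, rfl⟩) (by simp),
        .both (Nat.succ_ne_self _) hj.symm⟩
  | @both i₀ i₁ j₀ j₁ hi hj =>
    cases hL with
    | unfire h => simp at h
    | under _ hj h =>
      obtain ⟨rfl, rfl, rfl, rfl⟩ := tr_firedK.1 h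
      exact ⟨i₁, _, .parR (tr_firedK.2 ⟨rfl, rfl, rfl, rfl⟩) (by simpa using hi.symm), .left _ _⟩

/-- The run of `a ∣ a` that executes both actions. -/
theorem run_par_prefix (a : N) :
    Run (CCS.par (CCS.pre (.name a) CCS.zero) (CCS.pre (.name a) CCS.zero)).emb
      [(1, .vis (.name a)), (0, .vis (.name a))] (.par (firedK a 0) (firedK a 1)) :=
  .snoc (.snoc .nil (.parL (tr_prefixK.2 ⟨rfl, rfl, rfl⟩) (keys_prefixK a ▸ Set.notMem_empty 0)))
    (.parR (tr_prefixK.2 ⟨rfl, rfl, rfl⟩) (by simp))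

theorem not_withoutAutoConcurrency (a : N) :
    ¬ (CCS.par (CCS.pre (.name a) CCS.zero)
      (CCS.pre (.name a) CCS.zero)).encode.WithoutAutoConcurrency := by
  intro h
  have := h.key_unique (run_par_prefix a)
    (.parL (tr_firedK.2 ⟨rfl, rfl, rfl, rfl⟩) (by simp))
    (.parR (tr_firedK.2 ⟨rfl, rfl, rfl, rfl⟩) (by simp))
  exact zero_ne_one this

variable [DecidableEq N] [Infinite N]

theorem sbf_par_prefix (a : N) :
    SBF (CCS.par (CCS.pre (.name a) CCS.zero) (CCS.pre (.name a) CCS.zero))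
      (CCS.pre (.name a) (CCS.pre (.name a) CCS.zero)) := by
  have key₁ : ∀ d R₁ R₂, (∃ K L, Sim R₁ K ∧ Sim R₂ L ∧ SameCount a K L) → ∀ i α S₁,
      Step d R₁ i α S₁ → ∃ j S₂, Step d R₂ j α S₂ ∧
        ∃ K L, Sim S₁ K ∧ Sim S₂ L ∧ SameCount a K L := by
    rintro d R₁ R₂ ⟨K, L, hK, hL, h⟩ i α S₁ hs
    obtain ⟨K', hK', hS₁⟩ := hK.tr hs
    obtain ⟨j, L', hL', h'⟩ := h.tr_left hK'
    obtain ⟨S₂, hS₂, hL'⟩ := hL.step hL'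
    exact ⟨j, S₂, hS₂, K', L', hS₁, hL', h'⟩
  have key₂ : ∀ d R₁ R₂, (∃ K L, Sim R₁ K ∧ Sim R₂ L ∧ SameCount a K L) → ∀ j α S₂,
      Step d R₂ j α S₂ → ∃ i S₁, Step d R₁ i α S₁ ∧
        ∃ K L, Sim S₁ K ∧ Sim S₂ L ∧ SameCount a K L := by
    rintro d R₁ R₂ ⟨K, L, hK, hL, h⟩ j α S₂ hs
    obtain ⟨L', hL', hS₂⟩ := hL.tr hs
    obtain ⟨i, K', hK', h'⟩ := h.tr_right hL'
    obtain ⟨S₁, hS₁, hK'⟩ := hK.step hK'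
    exact ⟨i, S₁, hS₁, K', L', hK', hS₂, h'⟩
  exact ⟨fun R₁ R₂ => ∃ K L, Sim R₁ K ∧ Sim R₂ L ∧ SameCount a K L,
    ⟨_, _, sim_start _, sim_start _, .zero⟩, key₁ _, key₂ _, key₁ _, key₂ _⟩

/-- After both actions, `a ∣ a` can undo the first one, but `a.a` cannot. -/
theorem not_bf_par_prefix (a : N) :
    ¬ BF (CCS.par (CCS.pre (.name a) CCS.zero) (CCS.pre (.name a) CCS.zero))
      (CCS.pre (.name a) (CCS.pre (.name a) CCS.zero)) := by
  rintro ⟨Rel, h⟩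
  have t₀ : Tr .fwd (.par (prefixK a) (prefixK a)) 0 (.vis (.name a))
      (.par (firedK a 0) (prefixK a)) := .parL (tr_prefixK.2 ⟨rfl, rfl, rfl⟩) (by simp)
  have t₁ : Tr .fwd (.par (firedK a 0) (prefixK a)) 1 (.vis (.name a))
      (.par (firedK a 0) (firedK a 1)) := .parR (tr_prefixK.2 ⟨rfl, rfl, rfl⟩) (by simp)
  have t₂ : Tr .bwd (.par (firedK a 0) (firedK a 1)) 0 (.vis (.name a))
      (.par (prefixK a) (firedK a 1)) := .parL (tr_firedK.2 ⟨rfl, rfl, rfl, rfl⟩) (by simp)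
  obtain ⟨S₀, s₀, hS₀⟩ := (sim_start (.par (.pre (.name a) .zero) (.pre (.name a) .zero))).step t₀
  obtain ⟨S₁, s₁, hS₁⟩ := hS₀.step t₁
  obtain ⟨S₂, s₂, -⟩ := hS₁.step t₂
  obtain ⟨j₀, T₀, u₀, hr₀⟩ := h.forth₁ _ _ _ h.start _ _ _ s₀
  obtain ⟨j₁, T₁, u₁, hr₁⟩ := h.forth₁ _ _ _ hr₀ _ _ _ s₁
  obtain ⟨j, T₂, u₂, hj, -⟩ := h.back₁ _ _ _ hr₁ _ _ _ s₂
  obtain rfl : j₀ = j := by simpa [Function.update_apply] using hj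
  obtain ⟨L₀, v₀, hT₀⟩ := (sim_start _).tr u₀
  obtain ⟨-, -, rfl⟩ := tr_cons_nil v₀
  obtain ⟨L₁, v₁, hT₁⟩ := hT₀.tr u₁
  obtain ⟨L₂, v₂, -⟩ := hT₁.tr u₂
  cases v₁ with
  | under _ hne v₁ =>
    obtain ⟨-, -, rfl⟩ := tr_prefixK.1 v₁
    cases v₂ with
    | unfire h => simp at h
    | under _ hne => exact hne rfl

end RCCS

theorem mainTheorem4 {N : Type*} [DecidableEq N] [Infinite N] :
    (∀ (R₁ R₂ : RCCS N) (O₁ O₂ : CCS N),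
      RCCS.IsOrigin O₁ R₁ → RCCS.IsOrigin O₂ R₂ →
      O₁.encode.WithoutAutoConcurrency → O₂.encode.WithoutAutoConcurrency →
        (RCCS.BF O₁ O₂ ↔ RCCS.SBF O₁ O₂) ∧
        ((∃ Rel, RCCS.IsBF O₁ O₂ Rel ∧ ∃ f, Rel R₁ R₂ f) ↔
          ∃ Rel, RCCS.IsSBF O₁ O₂ Rel ∧ Rel R₁ R₂)) ∧
    (∀ a : N,
      ¬ (CCS.par (CCS.pre (.name a) CCS.zero)
          (CCS.pre (.name a) CCS.zero)).encode.WithoutAutoConcurrency ∧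
      RCCS.SBF (CCS.par (CCS.pre (.name a) CCS.zero) (CCS.pre (.name a) CCS.zero))
        (CCS.pre (.name a) (CCS.pre (.name a) CCS.zero)) ∧
      ¬ RCCS.BF (CCS.par (CCS.pre (.name a) CCS.zero) (CCS.pre (.name a) CCS.zero))
        (CCS.pre (.name a) (CCS.pre (.name a) CCS.zero))) := by
  refine ⟨fun R₁ R₂ O₁ O₂ hR₁ hR₂ h₁ h₂ => ⟨⟨?_, ?_⟩, ⟨?_, ?_⟩⟩, fun a =>
    ⟨RCCS.not_withoutAutoConcurrency a, RCCS.sbf_par_prefix a, RCCS.not_bf_par_prefix a⟩⟩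
  · rintro ⟨Rel, h⟩
    exact ⟨_, h.isSBF⟩
  · rintro ⟨Rel, h⟩
    exact ⟨_, h.isBF_lift h₁ h₂⟩
  · rintro ⟨Rel, h, f, hf⟩
    exact ⟨_, h.isSBF, f, hf⟩
  · rintro ⟨Rel, h, hr⟩
    obtain ⟨σ₁, K₁, hK₁, hσ₁⟩ := hR₁.exists_run
    obtain ⟨σ₂, K₂, hK₂, hσ₂⟩ := hR₂.exists_run
    obtain ⟨f, hf⟩ := h.exists_matches h₂ hr hK₁ hK₂ hσ₁ hσ₂
    exact ⟨_, h.isBF_lift h₁ h₂, f, hr, K₁, K₂, σ₁, σ₂, hK₁, hK₂, hσ₁, hσ₂, hf⟩
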